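/- **Setting.** Let $M$ be a closed smooth manifold of dimension $2n$ with a symplectic form $\omega_0$, let $H\in C^\infty(\mathbb R/\mathbb Z\times M)$, and let $J$ be a smooth almost complex structure on $M$. For a non-degenerate 2-form $\omega$ let $X_H^\omega$ be the Hamiltonian vector field, $\omega(\cdot,X_H^\omega)=d(H(t,\cdot))$. Fix a finite cover of $M$ by smooth charts $\phi_i:B_i\to B(0,1)\subset\mathbb R^{2n}$ onto the open unit ball and positive numbers $\epsilon_k$, $k\ge 0$. For a 2-form $\alpha$ let $\|\alpha\|_k$ be the supremum over $B(0,1)$ of the absolute values of all partial derivatives of order $k$ of all coefficients of $\alpha$ in these charts, and put $|\alpha|=\sum_{k\ge0}\epsilon_k\|\alpha\|_k\in[0,\infty]$. For $\delta>0$ let $\Omega_\delta$ be the set of smooth closed 2-forms $\alpha$ with $|\alpha|\le\delta$ that vanish in a neighbourhood of every 1-periodic orbit of $X_H^{\omega_0}$. Let $0<\delta_*<\delta_1$, where $\delta_1$ is so small that $J$ is $(\omega_0+\beta)$-tame for every $\beta\in\Omega_{\delta_1}$, and put $\Omega=\Omega_{\delta_*}$. For $\alpha\in\Omega$ and a smooth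 cut-off function $\kappa:\mathbb R\to\mathbb R$ ($\kappa=0$ on $(-\infty,0]$, $\kappa=1$ on $[1,\infty)$, $\kappa'>0$ on $(0,1)$) put $\omega_s=\omega_0+\kappa(s)\alpha$, $\omega_1=\omega_0+\alpha$ and $g_s(v,w)=\frac12(\omega_s(v,Jw)+\omega_s(w,Jv))$. A capped loop $(\gamma,w)$ is a loop $\gamma:\mathbb R/\mathbb Z\to M$ with a smooth map $w:D^2\to M$ of the closed disc such that $w(e^{2\pi it})=\gamma(t)$, and $$\mathcal A_\omega([\gamma,w])=-\int_{D^2}w^*\omega+\int_0^1H(t,\gamma(t))\,dt .$$ A *Floer connecting trajectory* from $[\gamma_-,w_-]$ to $[\gamma_+,w_+]$ is a smooth map $u:\mathbb R\times\mathbb R/\mathbb Z\to M$ such that (a) $\partial_su+J(u)\big(\partial_tu-X_H^{\omega_s}(t,u)\big)=0$, with finite energy $$E(u)=\frac12\int_{-\infty}^{\infty}\int_0^1\Big(|\partial_su|_{g_s}^2+|\partial_tu-X_H^{\omega_s}|_{g_s}^2\Big)\,dt\,ds<\infty ;$$ (b) $\lim_{s\to\pm\infty}u(s,t)=\gamma_\pm(t)$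 for every $t$; (c) $[\gamma_+,w_+]=[\gamma_+,w_-\#u]$, that is, $w_-\#u\#(-w_+)$ is zero in $H_2(M;\mathbb R)=H^2_{dR}(M)^*$: for every smooth closed 2-form $\beta$ one has $\int_{D^2}w_+^*\beta=\int_{D^2}w_-^*\beta+\lim_{S\to\infty}\int_{[-S,S]\times\mathbb R/\mathbb Z}u^*\beta$. **Proposition 1.5.** Let $U\subset M$ be an open set that contains all 1-periodic orbits of $X_H^{\omega_0}$. There are constants $C\ge 0$ and $N>0$ such that for every $\alpha\in\Omega$ that vanishes on $U$, every cut-off function $\kappa$, and every Floer connecting trajectory $u$ from $[\gamma_-,w_-]$ to $[\gamma_+,w_+]$ with energy $E=E(u)$, $$-(1+C')E-\int_{D^2}w_-^*\alpha\ \le\ \mathcal A_{\omega_1}([\gamma_+,w_+])-\mathcal A_{\omega_0}([\gamma_-,w_-])\ \le\ -(1-C')E-\int_{D^2}w_-^*\alpha ,\qquad C'=|\alpha|\Big(\frac{C}{\sqrt N}+1\Big).$$ In particular, for each $\alpha\in\Omega$ the constants $C$ and $N$ do not depend on $u$. -/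

import Mathlib

open Set Filter Topology MeasureTheory
open scoped Manifold ContDiff ENNReal

noncomputable section

namespace FloerPerturbation

/-- The model space of a `2n`-dimensional manifold. -/
abbrev Model (n : ℕ) : Type := EuclideanSpace ℝ (Fin (2 * n))

section Forms

variable {n : ℕ} {M : Type*} [TopologicalSpace M] [ChartedSpace (Model n) M]

variable (n M) in
/-- (Not necessarily continuous) differential 2-forms on `M`: an alternating bilinear form on
every tangent space. -/
abbrev TwoForm : Type _ := ∀ x : M, TangentSpace (𝓡 (2 * n)) x [⋀^Fin 2]→L[ℝ] ℝ

variable (n M) in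
/-- Fields of endomorphisms of the tangent bundle. -/
abbrev EndField : Type _ :=
  ∀ x : M, TangentSpace (𝓡 (2 * n)) x →L[ℝ] TangentSpace (𝓡 (2 * n)) x

/-- The coordinate expression `(φ⁻¹)^* σ` of a 2-form in a chart `φ`. -/
def inChart (σ : TwoForm n M) (φ : OpenPartialHomeomorph M (Model n)) :
    Model n → Model n [⋀^Fin 2]→L[ℝ] ℝ := fun y =>
  (σ (φ.symm y)).compContinuousLinearMap
    (mfderiv 𝓘(ℝ, Model n) (𝓡 (2 * n)) φ.symm y :
      Model n →L[ℝ] TangentSpace (𝓡 (2 * n)) (φ.symm y))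

/-- A 2-form is smooth if it is smooth in every chart of the smooth structure. -/
def IsSmoothForm (σ : TwoForm n M) : Prop :=
  ∀ φ ∈ IsManifold.maximalAtlas (𝓡 (2 * n)) ∞ M, ContDiffOn ℝ ∞ (inChart σ φ) φ.target

/-- `dσ = 0`, the exterior derivative being computed in charts. -/
def IsClosedForm (σ : TwoForm n M) : Prop :=
  ∀ φ ∈ IsManifold.maximalAtlas (𝓡 (2 * n)) ∞ M, ∀ y ∈ φ.target, extDeriv (inChart σ φ) y = 0

/-- Symplectic forms: smooth, closed and non-degenerate. -/
structure IsSymplectic (σ : TwoForm n M) : Prop where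
  smooth : IsSmoothForm σ
  closed : IsClosedForm σ
  nondegenerate : ∀ (x : M) (v : TangentSpace (𝓡 (2 * n)) x), (∀ w, σ x ![v, w] = 0) → v = 0

/-- Smooth almost complex structures: smooth sections `J` of `End(TM)` with `J² = -1`. -/
structure IsAlmostComplex [IsManifold (𝓡 (2 * n)) ∞ M] (J : EndField n M) : Prop where
  smooth : ContMDiff (𝓡 (2 * n)) ((𝓡 (2 * n)).prod 𝓘(ℝ, Model n →L[ℝ] Model n)) ∞
    (fun x => Bundle.TotalSpace.mk' (Model n →L[ℝ] Model n)
      (E := fun x : M => TangentSpace (𝓡 (2 * n)) x →L[ℝ] TangentSpace (𝓡 (2 * n)) x) x (J x))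
  sq_eq : ∀ x v, J x (J x v) = -v

/-- `J` is `σ`-tame. -/
def Tames (σ : TwoForm n M) (J : EndField n M) : Prop :=
  ∀ (x : M) (v : TangentSpace (𝓡 (2 * n)) x), v ≠ 0 → 0 < σ x ![v, J x v]

/-- The metric `g(v, w) = (σ(v, J w) + σ(w, J v)) / 2`. -/
def metric (σ : TwoForm n M) (J : EndField n M) (x : M)
    (v w : TangentSpace (𝓡 (2 * n)) x) : ℝ :=
  (σ x ![v, J x w] + σ x ![w, J x v]) / 2

/-! ### Hamiltonian dynamics -/

/-- Smooth Hamiltonians on `ℝ/ℤ × M`, as functions of `t : ℝ` of period one. -/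
structure IsHamiltonian (H : ℝ → M → ℝ) : Prop where
  smooth : ContMDiff (𝓘(ℝ, ℝ).prod (𝓡 (2 * n))) 𝓘(ℝ, ℝ) ∞ (fun p : ℝ × M => H p.1 p.2)
  periodic : ∀ t x, H (t + 1) x = H t x

/-- The Hamiltonian vector field `X = X_H^σ(t, ·)`, i.e. the solution of `σ(·, X) = d(H_t)`.
For non-degenerate `σ` the solution exists and is unique. -/
def hamVF (σ : TwoForm n M) (H : ℝ → M → ℝ) (t : ℝ) (x : M) : TangentSpace (𝓡 (2 * n)) x :=
  Classical.epsilon fun X : TangentSpace (𝓡 (2 * n)) x =>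
    ∀ v : TangentSpace (𝓡 (2 * n)) x,
      σ x ![v, X] = (mfderiv (𝓡 (2 * n)) 𝓘(ℝ, ℝ) (H t) x : _ →L[ℝ] ℝ) v

/-- `x` is a Hamiltonian 1-periodic orbit: `x'(t) = X_H^σ(t, x(t))`, `x(t + 1) = x(t)`. -/
structure IsPeriodicOrbit (σ : TwoForm n M) (H : ℝ → M → ℝ) (x : ℝ → M) : Prop where
  deriv : ∀ t, HasMFDerivAt 𝓘(ℝ, ℝ) (𝓡 (2 * n)) x t
    ((1 : ℝ →L[ℝ] ℝ).smulRight (hamVF σ H t (x t)))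
  periodic : ∀ t, x (t + 1) = x t

/-! ### The norm and the class of perturbations -/

/-- A finite cover of `M` by smooth charts, each of which is onto the open unit ball. -/
structure BallCover (n : ℕ) (M : Type*) [TopologicalSpace M] [ChartedSpace (Model n) M] where
  /-- the number of charts -/
  card : ℕ
  /-- the charts -/
  chart : Fin card → OpenPartialHomeomorph M (Model n)
  mem_atlas : ∀ i, chart i ∈ IsManifold.maximalAtlas (𝓡 (2 * n)) ∞ M
  target_eq : ∀ i, (chart i).target = Metric.ball 0 1
  covers : ⋃ i, (chart i).source = univ

/-- The coefficient `f_{i,a,b}` of `dx_a ∧ dx_b` in the `i`-th chart. -/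
def coeff (B : BallCover n M) (α : TwoForm n M) (i : Fin B.card) (a b : Fin (2 * n)) :
    Model n → ℝ := fun y =>
  inChart α (B.chart i) y ![EuclideanSpace.single a 1, EuclideanSpace.single b 1]

/-- The `k`-norm: the supremum over all charts, all coefficients, all points of the unit ball
and all partial derivatives of order `k`. -/
def kNorm (B : BallCover n M) (k : ℕ) (α : TwoForm n M) : ℝ≥0∞ :=
  ⨆ (i : Fin B.card) (a : Fin (2 * n)) (b : Fin (2 * n)) (y ∈ Metric.ball (0 : Model n) 1)
    (l : Fin k → Fin (2 * n)),
    ‖iteratedFDeriv ℝ k (coeff B α i a b) y (fun j => EuclideanSpace.single (l j) 1)‖ₑ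

/-- The `ε`-norm `∑ₖ εₖ ‖α‖ₖ`, possibly infinite. -/
def epsNorm (B : BallCover n M) (ε : ℕ → ℝ) (α : TwoForm n M) : ℝ≥0∞ :=
  ∑' k, ENNReal.ofReal (ε k) * kNorm B k α

/-- The class `Ω` of perturbations of size at most `δ`: closed 2-forms which vanish in a
neighbourhood of every 1-periodic orbit of `(ω₀, H)` and have `ε`-norm at most `δ`. -/
structure IsPerturbation (B : BallCover n M) (ε : ℕ → ℝ) (ω₀ : TwoForm n M) (H : ℝ → M → ℝ)
    (δ : ℝ) (α : TwoForm n M) : Prop where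
  smooth : IsSmoothForm α
  closed : IsClosedForm α
  vanishes : ∀ x, IsPeriodicOrbit ω₀ H x → ∀ᶠ y in 𝓝ˢ (range x), α y = 0
  norm_le : epsNorm B ε α ≤ ENNReal.ofReal δ

/-! ### The homotopy of forms, capped loops, action -/

/-- Smooth cut-off functions. -/
structure IsCutoff (κ : ℝ → ℝ) : Prop where
  smooth : ContDiff ℝ ∞ κ
  eq_zero : ∀ s ≤ 0, κ s = 0
  eq_one : ∀ s, 1 ≤ s → κ s = 1
  deriv_pos : ∀ s ∈ Ioo (0 : ℝ) 1, 0 < deriv κ s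

/-- The interpolation `ω_s = ω₀ + κ(s) α`. -/
def interp (ω₀ α : TwoForm n M) (κ : ℝ → ℝ) (s : ℝ) : TwoForm n M := ω₀ + κ s • α

/-- `w` is a smooth map of the closed unit disc whose boundary loop is `γ`. -/
structure IsCapping (γ : ℝ → M) (w : ℂ → M) : Prop where
  smooth : ContMDiffOn 𝓘(ℝ, ℂ) (𝓡 (2 * n)) ∞ w (Metric.closedBall 0 1)
  boundary : ∀ t : ℝ, w (Complex.exp (2 * Real.pi * t * Complex.I)) = γ t

/-- `∫_{D²} w^* σ`. -/
def discIntegral (σ : TwoForm n M) (w : ℂ → M) : ℝ :=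
  ∫ z in Metric.ball (0 : ℂ) 1,
    σ (w z) ![(mfderiv 𝓘(ℝ, ℂ) (𝓡 (2 * n)) w z : ℂ →L[ℝ] TangentSpace (𝓡 (2 * n)) (w z)) (1 : ℂ),
      (mfderiv 𝓘(ℝ, ℂ) (𝓡 (2 * n)) w z : ℂ →L[ℝ] TangentSpace (𝓡 (2 * n)) (w z)) Complex.I]

/-- The action functional `A_σ([γ, w]) = -∫_{D²} w^* σ + ∫₀¹ H(t, γ(t)) dt`. -/
def action (σ : TwoForm n M) (H : ℝ → M → ℝ) (γ : ℝ → M) (w : ℂ → M) : ℝ :=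
  -discIntegral σ w + ∫ t in (0 : ℝ)..1, H t (γ t)

/-! ### Floer connecting trajectories -/

/-- `∂u/∂s`. -/
def dS (u : ℝ × ℝ → M) (p : ℝ × ℝ) : TangentSpace (𝓡 (2 * n)) (u p) :=
  (mfderiv 𝓘(ℝ, ℝ × ℝ) (𝓡 (2 * n)) u p : ℝ × ℝ →L[ℝ] TangentSpace (𝓡 (2 * n)) (u p)) ((1, 0) : ℝ × ℝ)

/-- `∂u/∂t`. -/
def dT (u : ℝ × ℝ → M) (p : ℝ × ℝ) : TangentSpace (𝓡 (2 * n)) (u p) :=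
  (mfderiv 𝓘(ℝ, ℝ × ℝ) (𝓡 (2 * n)) u p : ℝ × ℝ →L[ℝ] TangentSpace (𝓡 (2 * n)) (u p)) ((0, 1) : ℝ × ℝ)

/-- `|∂u/∂s|² + |∂u/∂t - X_H^{ω_s}|²` at `p = (s, t)`, both norms being those of the metric
`g_s` of `ω_s` and `J`. -/
def energyDensity (σ : ℝ → TwoForm n M) (J : EndField n M) (H : ℝ → M → ℝ) (u : ℝ × ℝ → M)
    (p : ℝ × ℝ) : ℝ :=
  metric (σ p.1) J (u p) (dS u p) (dS u p) +
    metric (σ p.1) J (u p) (dT u p - hamVF (σ p.1) H p.2 (u p))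
      (dT u p - hamVF (σ p.1) H p.2 (u p))

/-- The energy `E(u) = ½ ∫_{-∞}^{∞} ∫₀¹ |∂u/∂s|² + |∂u/∂t - X_H^{ω_s}|² dt ds`. -/
def energy (σ : ℝ → TwoForm n M) (J : EndField n M) (H : ℝ → M → ℝ) (u : ℝ × ℝ → M) : ℝ :=
  (1 / 2) * ∫ p in (univ : Set ℝ) ×ˢ Icc (0 : ℝ) 1, energyDensity σ J H u p

/-- `w₊` and `w₋ # u` are the same capping in real homology: the cycle `w₋ # u # (-w₊)` is zero
in `H₂(M; ℝ)`, which is the dual of the second de Rham cohomology of the closed manifold `M`.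
So every closed 2-form `β` has the same integral over `w₊` and over `w₋ # u`. The integral over
the cylinder `ℝ × ℝ/ℤ` is the limit of the integrals over `[-S, S] × ℝ/ℤ`. -/
def HomologousCapping (wm wp : ℂ → M) (u : ℝ × ℝ → M) : Prop :=
  ∀ β : TwoForm n M, IsSmoothForm β → IsClosedForm β →
    Tendsto (fun S : ℝ => discIntegral β wm +
        ∫ s in (-S)..S, ∫ t in (0 : ℝ)..1, β (u (s, t)) ![dS u (s, t), dT u (s, t)])
      atTop (𝓝 (discIntegral β wp))

/-- `u : ℝ × ℝ/ℤ → M` is a Floer connecting trajectory of finite energy from `[γ₋, w₋]` to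
`[γ₊, w₊]` for the family `s ↦ σ s` of symplectic forms. -/
structure IsConnectingTrajectory (σ : ℝ → TwoForm n M) (J : EndField n M) (H : ℝ → M → ℝ)
    (γm : ℝ → M) (wm : ℂ → M) (γp : ℝ → M) (wp : ℂ → M) (u : ℝ × ℝ → M) : Prop where
  smooth : ContMDiff 𝓘(ℝ, ℝ × ℝ) (𝓡 (2 * n)) ∞ u
  periodic : ∀ s t, u (s, t + 1) = u (s, t)
  floer : ∀ p : ℝ × ℝ, dS u p + J (u p) (dT u p - hamVF (σ p.1) H p.2 (u p)) = 0
  finite_energy : IntegrableOn (energyDensity σ J H u) ((univ : Set ℝ) ×ˢ Icc (0 : ℝ) 1)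
  limit_neg : ∀ t, Tendsto (fun s => u (s, t)) atBot (𝓝 (γm t))
  limit_pos : ∀ t, Tendsto (fun s => u (s, t)) atTop (𝓝 (γp t))
  homologous : HomologousCapping (n := n) wm wp u

end Forms

end FloerPerturbation

end

/-!
Write `g₀(v, v) = ω₀(v, J v)`. Floer's equation says `J ∂_s u = ∂_t u - X`, so the energy density is
`|∂_s u|² = ω_s(∂_s u, ∂_t u) - dH(∂_s u)` in the metric of `ω_s`. Integrating this over the cylinder
and comparing the cappings by homology gives the energy identity
(`IsConnectingTrajectory.action_sub_action`): the action difference equals `-E - ∫ w₋^* α - R` with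
`R = ∫∫ (1 - κ(s)) α(∂_s u, ∂_t u)`. It remains to show `|R| ≤ const * |α| * E`
(`exists_integral_defect_le`).

Rescaling `α` to size `δ₁` shows that `ω_s(v, J v) ≥ (1 - δ/δ₁) g₀(v, v)`
(`IsPerturbation.tame_interp`), hence `X` is bounded uniformly in `α` and
`|α(∂_s u, ∂_t u)| ≤ const * |α| * (|∂_s u|² + |∂_s u|)`. The linear term is the difficulty. It
vanishes where `u` lies in `U`. By a compactness argument
(`Tames.exists_almostOrbit_subset`) a loop for which `∫ |x' - X_H^{ω₀}|²` is at most some `N > 0`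
stays in `U`, with a margin `r` measured in a Euclidean embedding of `M`.

* For `s ≤ 0` the form is `ω₀`, so either the slice `u(s, ·)` carries energy at least `N`, and then
  the linear term is absorbed by the quadratic one, or it lies in `U`.
* For `s ≥ 1` the integrand vanishes.
* For `0 ≤ s ≤ 1` nothing is known about the periodic orbits of `ω_s` outside `U`. If `E ≥ N`, the
  strip has bounded area and the linear term is at most `E + 1 ≤ const * E`. If `E < N`, some slice
  `u(s₀, ·)` with `s₀ ∈ [-1, 0]` has energy at most `N`, so lies in `U` with margin `r`; for each
  `t` for which `u(·, t)` leaves `U` over `[0, 1]`, the curve `u(·, t)` has length bounded below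
  over `[-1, 1]`, so it carries a definite amount of energy, which again absorbs the linear term.

`integral_strip_le` is the resulting estimate for functions on the strip. Since the constant `C` of
the theorem is free, `N = 1` is used there.
-/

noncomputable section

namespace FloerPerturbation

section Estimates

set_option linter.unusedSectionVars false

variable {n : ℕ} {M : Type*} [TopologicalSpace M] [ChartedSpace (Model n) M]
  [IsManifold (𝓡 (2 * n)) ∞ M]

/-! ### Coordinate expressions in charts -/

/-- The differential at `x` of a map with values in a normed space, with codomain the space
itself rather than its tangent space. -/
def diff {E' : Type*} [NormedAddCommGroup E'] [NormedSpace ℝ E'] (f : M → E') (x : M) :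
    TangentSpace (𝓡 (2 * n)) x →L[ℝ] E' :=
  mfderiv (𝓡 (2 * n)) 𝓘(ℝ, E') f x

lemma chart_mdifferentiable {φ : OpenPartialHomeomorph M (Model n)}
    (hφ : φ ∈ IsManifold.maximalAtlas (𝓡 (2 * n)) ∞ M) :
    φ.MDifferentiable (𝓡 (2 * n)) (𝓡 (2 * n)) :=
  ⟨(contMDiffOn_of_mem_maximalAtlas hφ).mdifferentiableOn (by simp),
    (contMDiffOn_symm_of_mem_maximalAtlas hφ).mdifferentiableOn (by simp)⟩

lemma chartAt_mem (x : M) :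
    chartAt (Model n) x ∈ IsManifold.maximalAtlas (𝓡 (2 * n)) ∞ M :=
  IsManifold.chart_mem_maximalAtlas x

lemma symm_diff_apply {φ : OpenPartialHomeomorph M (Model n)}
    (hφ : φ ∈ IsManifold.maximalAtlas (𝓡 (2 * n)) ∞ M) {x : M} (hx : x ∈ φ.source)
    (v : TangentSpace (𝓡 (2 * n)) x) :
    (mfderiv 𝓘(ℝ, Model n) (𝓡 (2 * n)) φ.symm (φ x) : Model n →L[ℝ] Model n)
      (diff φ x v) = v := by
  have h := (chart_mdifferentiable hφ).symm_comp_deriv hx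
  exact DFunLike.congr_fun h v

lemma exists_diff_eq {φ : OpenPartialHomeomorph M (Model n)}
    (hφ : φ ∈ IsManifold.maximalAtlas (𝓡 (2 * n)) ∞ M) {x : M} (hx : x ∈ φ.source)
    (e : Model n) : ∃ v : TangentSpace (𝓡 (2 * n)) x, diff φ x v = e :=
  (chart_mdifferentiable hφ).mfderiv_surjective hx e

lemma form_eq_inChart (σ : TwoForm n M) {φ : OpenPartialHomeomorph M (Model n)}
    (hφ : φ ∈ IsManifold.maximalAtlas (𝓡 (2 * n)) ∞ M) {x : M} (hx : x ∈ φ.source)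
    (v w : TangentSpace (𝓡 (2 * n)) x) :
    σ x ![v, w] = inChart σ φ (φ x) ![diff φ x v, diff φ x w] := by
  -- moves the base point from `φ.symm (φ x)` to `x`
  have key : ∀ (x' : M) (hxx : x' = x) (a b : Model n), a = v → b = w →
      σ x ![v, w] = (σ x') ![(a : TangentSpace (𝓡 (2 * n)) x'), b] := by
    rintro x' rfl a b rfl rfl
    rfl
  rw [key (φ.symm (φ x)) (φ.left_inv hx) _ _ (symm_diff_apply hφ hx v)
    (symm_diff_apply hφ hx w)]
  refine congrArg (σ (φ.symm (φ x))) ?_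
  ext i : 1
  fin_cases i <;> rfl

lemma continuousAt_inChart {σ : TwoForm n M} (hσ : IsSmoothForm σ)
    {φ : OpenPartialHomeomorph M (Model n)}
    (hφ : φ ∈ IsManifold.maximalAtlas (𝓡 (2 * n)) ∞ M) {x : M} (hx : x ∈ φ.source) :
    ContinuousAt (fun x => inChart σ φ (φ x)) x :=
  ((hσ φ hφ).continuousOn.continuousAt (φ.open_target.mem_nhds (φ.map_source hx))).comp
    (φ.continuousAt hx)

/-- Chain rule in a chart for a map depending on a real parameter: the differential factors
through that of the chart by a linear map which is continuous in the parameter and the point. -/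
lemma diff_eq_fderiv_chart {E' : Type*} [NormedAddCommGroup E'] [NormedSpace ℝ E']
    {f : ℝ → M → E'} {t₀ : ℝ} {x₀ : M}
    (hf : ContMDiffAt (𝓘(ℝ, ℝ).prod (𝓡 (2 * n))) 𝓘(ℝ, E') ∞ (fun p : ℝ × M => f p.1 p.2) (t₀, x₀))
    {φ : OpenPartialHomeomorph M (Model n)}
    (hφ : φ ∈ IsManifold.maximalAtlas (𝓡 (2 * n)) ∞ M) (hx : x₀ ∈ φ.source) :
    ∃ L : ℝ → M → Model n →L[ℝ] E', ContinuousAt (fun p : ℝ × M => L p.1 p.2) (t₀, x₀) ∧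
      ∀ᶠ p : ℝ × M in 𝓝 (t₀, x₀), ∀ v : TangentSpace (𝓡 (2 * n)) p.2,
        diff (f p.1) p.2 v = L p.1 p.2 (diff φ p.2 v) := by
  set g : ℝ × Model n → E' := fun p => f p.1 (φ.symm p.2) with hg
  have hy : φ x₀ ∈ φ.target := φ.map_source hx
  have hsymm : ContMDiffAt 𝓘(ℝ, Model n) (𝓡 (2 * n)) ∞ φ.symm (φ x₀) :=
    (contMDiffOn_symm_of_mem_maximalAtlas hφ).contMDiffAt (φ.open_target.mem_nhds hy)
  have hgs : ContDiffAt ℝ 2 g (t₀, φ x₀) := by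
    rw [← contMDiffAt_iff_contDiffAt]
    have h1 : ContMDiffAt 𝓘(ℝ, ℝ × Model n) (𝓘(ℝ, ℝ).prod (𝓡 (2 * n))) ∞
        (fun p : ℝ × Model n => (p.1, φ.symm p.2)) (t₀, φ x₀) := by
      apply ContMDiffAt.prodMk
      · exact contDiff_fst.contMDiff.contMDiffAt
      · exact hsymm.comp (t₀, φ x₀) (f := Prod.snd) contDiff_snd.contMDiff.contMDiffAt
    refine ContMDiffAt.of_le (n := ∞) ?_ (by norm_cast)
    refine ContMDiffAt.comp (t₀, φ x₀) (g := fun p : ℝ × M => f p.1 p.2) ?_ h1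
    simpa [φ.left_inv hx] using hf
  refine ⟨fun t x => (fderiv ℝ g (t, φ x)).comp (ContinuousLinearMap.inr ℝ ℝ (Model n)), ?_, ?_⟩
  · have hc : ContinuousAt (fderiv ℝ g) (t₀, φ x₀) :=
      (hgs.fderiv_right (m := 1) (by norm_num)).continuousAt
    have hp : ContinuousAt (fun p : ℝ × M => (p.1, φ p.2)) (t₀, x₀) :=
      continuousAt_fst.prodMk ((φ.continuousAt hx).comp' continuousAt_snd)
    have := ContinuousAt.comp (g := fderiv ℝ g) (x := (t₀, x₀)) hc hp
    exact this.clm_comp continuousAt_const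
  · have hev : ∀ᶠ q in 𝓝 (t₀, φ x₀), ContDiffAt ℝ 2 g q := hgs.eventually (by simp)
    have hp : ContinuousAt (fun p : ℝ × M => (p.1, φ p.2)) (t₀, x₀) :=
      continuousAt_fst.prodMk ((φ.continuousAt hx).comp' continuousAt_snd)
    filter_upwards [hp.eventually hev,
      continuousAt_snd.eventually (φ.open_source.mem_nhds hx)] with p hp1 hp2 v
    have hd : HasFDerivAt g (fderiv ℝ g (p.1, φ p.2)) (p.1, φ p.2) :=
      (hp1.differentiableAt (by norm_num)).hasFDerivAt
    have hd2 : HasFDerivAt (fun y => g (p.1, y))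
        ((fderiv ℝ g (p.1, φ p.2)).comp (ContinuousLinearMap.inr ℝ ℝ (Model n))) (φ p.2) :=
      HasFDerivAt.comp (φ p.2) hd (hasFDerivAt_prodMk_right p.1 (φ p.2))
    have hm : HasMFDerivAt (𝓡 (2 * n)) 𝓘(ℝ, E') (f p.1) p.2
        (((fderiv ℝ g (p.1, φ p.2)).comp (ContinuousLinearMap.inr ℝ ℝ (Model n))).comp
          (diff φ p.2)) := by
      have h0 : HasMFDerivAt (𝓡 (2 * n)) (𝓡 (2 * n)) φ p.2 (diff φ p.2) :=
        ((chart_mdifferentiable hφ).mdifferentiableAt hp2).hasMFDerivAt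
      have h1 := HasMFDerivAt.comp p.2 hd2.hasMFDerivAt h0
      refine h1.congr_of_eventuallyEq ?_
      filter_upwards [φ.open_source.mem_nhds hp2] with x hx
      simp [hg, φ.left_inv hx]
    rw [diff, hm.mfderiv]
    rfl

/-! ### The metric of a tame pair -/

/-- The coordinate expression of a smooth almost complex structure is continuous. -/
lemma IsAlmostComplex.exists_chart_expression {J : EndField n M} (hJ : IsAlmostComplex J) (x₀ : M) :
    ∃ L : M → Model n →L[ℝ] Model n, ContinuousAt L x₀ ∧
      ∀ᶠ x in 𝓝 x₀, ∀ v : TangentSpace (𝓡 (2 * n)) x,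
        diff (chartAt (Model n) x₀) x (J x v) = L x (diff (chartAt (Model n) x₀) x v) := by
  -- the trivialization of the tangent bundle at `x₀` is the differential of the chart at `x₀`
  have h := (contMDiffAt_hom_bundle _).1 (hJ.smooth x₀)
  refine ⟨_, h.2.continuousAt, ?_⟩
  filter_upwards [(chartAt (Model n) x₀).open_source.mem_nhds (mem_chart_source _ x₀)] with x hx v
  have hb : x ∈ (trivializationAt (Model n) (TangentSpace (𝓡 (2 * n))) x₀).baseSet := by
    simpa using hx
  have e : ∀ w : TangentSpace (𝓡 (2 * n)) x, diff (chartAt (Model n) x₀) x w =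
      (trivializationAt (Model n) (TangentSpace (𝓡 (2 * n))) x₀).continuousLinearMapAt ℝ x w := by
    intro w
    have := TangentBundle.continuousLinearMapAt_trivializationAt (I := 𝓡 (2 * n)) hx
    exact (DFunLike.congr_fun this w).symm
  rw [e, e]
  simp only [ContinuousLinearMap.inCoordinates]
  simp only [ContinuousLinearMap.comp_apply]
  rw [Bundle.Trivialization.symmL_continuousLinearMapAt _ hb]

/-- Near every point the quadratic form `ω(v, J v)` of a tame pair dominates the square of the
Euclidean norm in a chart. -/
lemma Tames.exists_lower_bound {σ : TwoForm n M} {J : EndField n M} (hσ : IsSmoothForm σ)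
    (hJ : IsAlmostComplex J) (ht : Tames σ J) (x₀ : M) :
    ∃ c : ℝ, 0 < c ∧ ∀ᶠ x in 𝓝 x₀, ∀ v : TangentSpace (𝓡 (2 * n)) x,
      c * ‖diff (chartAt (Model n) x₀) x v‖ ^ 2 ≤ σ x ![v, J x v] := by
  set φ := chartAt (Model n) x₀ with hφ
  have hmem := chartAt_mem (n := n) x₀
  have hx₀ : x₀ ∈ φ.source := mem_chart_source _ x₀
  obtain ⟨L, hL, hLJ⟩ := hJ.exists_chart_expression x₀
  set Q : M → Model n → ℝ := fun x e => inChart σ φ (φ x) ![e, L x e] with hQ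
  have hQv : ∀ᶠ x in 𝓝 x₀, ∀ v : TangentSpace (𝓡 (2 * n)) x,
      σ x ![v, J x v] = Q x (diff φ x v) := by
    filter_upwards [hLJ, φ.open_source.mem_nhds hx₀] with x hx hxs v
    rw [form_eq_inChart σ hmem hxs, hx]
  have hQc : ∀ e, ContinuousAt (fun p : M × Model n => Q p.1 p.2) (x₀, e) := by
    intro e
    have h1 : ContinuousAt (fun p : M × Model n => inChart σ φ (φ p.1)) (x₀, e) :=
      ContinuousAt.comp' (f := Prod.fst) (g := fun x => inChart σ φ (φ x))
        (continuousAt_inChart hσ hmem hx₀) continuousAt_fst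
    have h2 : ContinuousAt (fun p : M × Model n => (![p.2, L p.1 p.2] : Fin 2 → Model n))
        (x₀, e) := by
      refine continuousAt_pi.2 fun i => ?_
      fin_cases i
      · exact continuousAt_snd
      · exact (hL.comp' continuousAt_fst).clm_apply continuousAt_snd
    have h3 : Continuous (fun q : (Model n [⋀^Fin 2]→L[ℝ] ℝ) × (Fin 2 → Model n) => q.1 q.2) := by
      fun_prop
    exact h3.continuousAt.comp (h1.prodMk h2)
  have hpos : ∀ e : Model n, e ≠ 0 → 0 < Q x₀ e := by
    intro e he
    obtain ⟨v, rfl⟩ := exists_diff_eq hmem hx₀ e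
    rw [← hQv.self_of_nhds]
    exact ht x₀ v (by rintro rfl; exact he (map_zero _))
  have hhom : ∀ x (a : ℝ) e, Q x (a • e) = a ^ 2 * Q x e := by
    intro x a e
    have : (![a • e, L x (a • e)] : Fin 2 → Model n) = a • ![e, L x e] := by
      ext i : 1
      fin_cases i <;> simp
    simp only [hQ]
    rw [this]
    have := (inChart σ φ (φ x)).toAlternatingMap.toMultilinearMap.map_smul_univ
      (fun _ => a) ![e, L x e]
    simp only [Finset.prod_const, Finset.card_univ, Fintype.card_fin] at this
    exact this
  have hsph : ∃ c : ℝ, 0 < c ∧ ∀ᶠ x in 𝓝 x₀, ∀ e ∈ Metric.sphere (0 : Model n) 1, c ≤ Q x e := by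
    have hcomp : IsCompact (Metric.sphere (0 : Model n) 1) := isCompact_sphere 0 1
    rcases (Metric.sphere (0 : Model n) 1).eq_empty_or_nonempty with h | h
    · exact ⟨1, one_pos, by simp [h]⟩
    · have hcont : ContinuousOn (Q x₀) (Metric.sphere (0 : Model n) 1) := fun e _ =>
        ((hQc e).comp (f := fun e => (x₀, e)) (by fun_prop)).continuousWithinAt
      obtain ⟨e₀, he₀, hmin⟩ := hcomp.exists_isMinOn h hcont
      have hp := hpos e₀ (by rintro rfl; simp at he₀)
      refine ⟨Q x₀ e₀ / 2, by positivity, ?_⟩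
      refine hcomp.eventually_forall_of_forall_eventually fun e he => ?_
      have : Q x₀ e₀ / 2 < Q x₀ e := lt_of_lt_of_le (by linarith) (hmin he)
      exact ((hQc e).eventually (lt_mem_nhds this)).mono fun z hz => hz.le
  obtain ⟨c, hc, hcQ⟩ := hsph
  refine ⟨c, hc, ?_⟩
  filter_upwards [hQv, hcQ] with x hx1 hx2 v
  rw [hx1]
  set e := diff φ x v
  by_cases he : e = 0
  · have := hhom x 0 0
    simp at this
    simp [he, this]
  · have h1 := hx2 (‖e‖⁻¹ • e) (by simp [norm_smul, he])
    have h2 : Q x e = ‖e‖ ^ 2 * Q x (‖e‖⁻¹ • e) := by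
      rw [hhom]; field_simp
    rw [h2, mul_comm]
    gcongr

/-- The norm `√(σ(v, J v))` of a tangent vector in the metric of `σ` and `J`; it is meaningful
only where `σ(v, J v)` is nonnegative, in particular if `J` is `σ`-tame. -/
def tameNorm (σ : TwoForm n M) (J : EndField n M) (x : M) (v : TangentSpace (𝓡 (2 * n)) x) : ℝ :=
  √(σ x ![v, J x v])

lemma Tames.nonneg {σ : TwoForm n M} {J : EndField n M} (ht : Tames σ J) (x : M)
    (v : TangentSpace (𝓡 (2 * n)) x) : 0 ≤ σ x ![v, J x v] := by
  by_cases hv : v = 0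
  · refine le_of_eq ((σ x).map_coord_zero 0 ?_).symm
    simp [hv]
  · exact (ht x v hv).le

lemma Tames.tameNorm_sq {σ : TwoForm n M} {J : EndField n M} (ht : Tames σ J) (x : M)
    (v : TangentSpace (𝓡 (2 * n)) x) : tameNorm σ J x v ^ 2 = σ x ![v, J x v] :=
  Real.sq_sqrt (ht.nonneg x v)

lemma tameNorm_nonneg (σ : TwoForm n M) (J : EndField n M) (x : M)
    (v : TangentSpace (𝓡 (2 * n)) x) : 0 ≤ tameNorm σ J x v := Real.sqrt_nonneg _

section Bilinear

variable {V : Type*} [AddCommGroup V] [Module ℝ V] [TopologicalSpace V] (Λ : V [⋀^Fin 2]→L[ℝ] ℝ)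

lemma form_swap (v w : V) : Λ ![v, w] = -Λ ![w, v] := by
  have := Λ.map_swap ![w, v] (i := 0) (j := 1) (by simp)
  refine Eq.trans (congrArg Λ ?_) this
  ext i : 1
  fin_cases i <;> rfl

lemma update_pair {X : Type*} (v w w' : X) : Function.update ![v, w'] 1 w = ![v, w] := by
  ext i
  fin_cases i <;> rfl

lemma form_add_right (v w w' : V) : Λ ![v, w + w'] = Λ ![v, w] + Λ ![v, w'] := by
  have := Λ.toMultilinearMap.map_update_add ![v, 0] 1 w w'
  simp only [update_pair] at this
  exact this

lemma form_smul_right (a : ℝ) (v w : V) : Λ ![v, a • w] = a * Λ ![v, w] := by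
  have := Λ.toMultilinearMap.map_update_smul ![v, 0] 1 a w
  simp only [update_pair] at this
  exact this

lemma form_neg_right (v w : V) : Λ ![v, -w] = -Λ ![v, w] := by
  simpa using form_smul_right Λ (-1) v w

lemma form_sub_right (v w w' : V) : Λ ![v, w - w'] = Λ ![v, w] - Λ ![v, w'] := by
  rw [sub_eq_add_neg, form_add_right, form_neg_right, sub_eq_add_neg]

lemma form_add_left (v v' w : V) : Λ ![v + v', w] = Λ ![v, w] + Λ ![v', w] := by
  rw [form_swap, form_add_right, form_swap Λ v, form_swap Λ v']
  ring

lemma form_smul_left (a : ℝ) (v w : V) : Λ ![a • v, w] = a * Λ ![v, w] := by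
  rw [form_swap, form_smul_right, form_swap Λ v]
  ring

end Bilinear

lemma form_J_self {J : EndField n M} (hJ : IsAlmostComplex J) (σ : TwoForm n M) (x : M)
    (v : TangentSpace (𝓡 (2 * n)) x) : σ x ![J x v, J x (J x v)] = σ x ![v, J x v] := by
  rw [hJ.sq_eq, form_neg_right, ← form_swap]

/-- `J` is an isometry, although `J` need not be compatible with `σ`. -/
lemma tameNorm_J {J : EndField n M} (hJ : IsAlmostComplex J) (σ : TwoForm n M) (x : M)
    (v : TangentSpace (𝓡 (2 * n)) x) : tameNorm σ J x (J x v) = tameNorm σ J x v := by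
  rw [tameNorm, form_J_self hJ, tameNorm]

/-- The differential of a smooth map is bounded in terms of the tame norm near every point,
locally uniformly in a parameter. -/
lemma Tames.exists_diff_le {σ : TwoForm n M} {J : EndField n M} (hσ : IsSmoothForm σ)
    (hJ : IsAlmostComplex J) (ht : Tames σ J)
    {E' : Type*} [NormedAddCommGroup E'] [NormedSpace ℝ E'] {f : ℝ → M → E'} {t₀ : ℝ} {x₀ : M}
    (hf : ContMDiffAt (𝓘(ℝ, ℝ).prod (𝓡 (2 * n))) 𝓘(ℝ, E') ∞
      (fun p : ℝ × M => f p.1 p.2) (t₀, x₀)) :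
    ∃ K : ℝ, 0 ≤ K ∧ ∀ᶠ p : ℝ × M in 𝓝 (t₀, x₀), ∀ v : TangentSpace (𝓡 (2 * n)) p.2,
      ‖diff (f p.1) p.2 v‖ ≤ K * tameNorm σ J p.2 v := by
  obtain ⟨c, hc, hlow⟩ := ht.exists_lower_bound hσ hJ x₀
  obtain ⟨L, hL, hLf⟩ := diff_eq_fderiv_chart hf (chartAt_mem (n := n) x₀)
    (mem_chart_source _ x₀)
  have hb : ∀ᶠ p : ℝ × M in 𝓝 (t₀, x₀), ‖L p.1 p.2‖ < ‖L t₀ x₀‖ + 1 :=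
    hL.norm.eventually (gt_mem_nhds (lt_add_one _))
  refine ⟨(‖L t₀ x₀‖ + 1) / √c, by positivity, ?_⟩
  filter_upwards [hb, hLf, continuousAt_snd.eventually hlow] with p hp1 hp2 hp3 v
  rw [hp2]
  have h1 : √c * ‖diff (chartAt (Model n) x₀) p.2 v‖ ≤ tameNorm σ J p.2 v := by
    apply Real.le_sqrt_of_sq_le
    rw [mul_pow, Real.sq_sqrt hc.le]
    exact hp3 v
  have hc' : 0 < √c := Real.sqrt_pos.2 hc
  calc ‖L p.1 p.2 (diff (chartAt (Model n) x₀) p.2 v)‖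
      ≤ ‖L p.1 p.2‖ * ‖diff (chartAt (Model n) x₀) p.2 v‖ := ContinuousLinearMap.le_opNorm _ _
    _ ≤ (‖L t₀ x₀‖ + 1) * (tameNorm σ J p.2 v / √c) := by
        gcongr
        rw [le_div_iff₀ hc', mul_comm]
        exact h1
    _ = _ := by ring

/-- Local bounds with constants give a global bound on a compact set. -/
lemma exists_uniform_bound_of_isCompact {X : Type*} [TopologicalSpace X] {s : Set X}
    (hs : IsCompact s) {P : ℝ → X → Prop} (hmono : ∀ a b x, a ≤ b → P a x → P b x)
    (h : ∀ x ∈ s, ∃ K, ∀ᶠ y in 𝓝 x, P K y) : ∃ K : ℝ, 0 ≤ K ∧ ∀ x ∈ s, P K x := by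
  suffices ∃ K : ℝ, ∀ x ∈ s, P K x by
    obtain ⟨K, hK⟩ := this
    exact ⟨max K 0, le_max_right _ _, fun x hx => hmono _ _ x (le_max_left _ _) (hK x hx)⟩
  refine hs.induction_on (p := fun s => ∃ K : ℝ, ∀ x ∈ s, P K x) ⟨0, by simp⟩
    (fun s t hst ⟨K, hK⟩ => ⟨K, fun x hx => hK x (hst hx)⟩) ?_ ?_
  · rintro s t ⟨K, hK⟩ ⟨K', hK'⟩
    refine ⟨max K K', ?_⟩
    rintro x (hx | hx)
    · exact hmono _ _ x (le_max_left _ _) (hK x hx)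
    · exact hmono _ _ x (le_max_right _ _) (hK' x hx)
  · intro x hx
    obtain ⟨K, hK⟩ := h x hx
    exact ⟨_, mem_nhdsWithin_of_mem_nhds hK, K, fun y hy => hy⟩

lemma Tames.exists_diff_le_global [CompactSpace M] {σ : TwoForm n M} {J : EndField n M}
    (hσ : IsSmoothForm σ) (hJ : IsAlmostComplex J) (ht : Tames σ J)
    {E' : Type*} [NormedAddCommGroup E'] [NormedSpace ℝ E'] {f : M → E'}
    (hf : ContMDiff (𝓡 (2 * n)) 𝓘(ℝ, E') ∞ f) :
    ∃ K : ℝ, 0 ≤ K ∧ ∀ x, ∀ v : TangentSpace (𝓡 (2 * n)) x,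
      ‖diff f x v‖ ≤ K * tameNorm σ J x v := by
  obtain ⟨K, hK, h⟩ := exists_uniform_bound_of_isCompact (isCompact_univ (X := M))
    (P := fun K x => ∀ v : TangentSpace (𝓡 (2 * n)) x, ‖diff f x v‖ ≤ K * tameNorm σ J x v)
    (fun a b x hab h v => (h v).trans (by gcongr; exact tameNorm_nonneg ..)) (fun x _ => by
      obtain ⟨K, -, hK⟩ := ht.exists_diff_le hσ hJ (f := fun _ => f) (t₀ := 0) (x₀ := x)
        (hf.comp contMDiff_snd).contMDiffAt
      refine ⟨K, ?_⟩
      have hc : ContinuousAt (fun x : M => ((0 : ℝ), x)) x := by fun_prop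
      exact hc.eventually hK)
  exact ⟨K, hK, fun x => h x (mem_univ x)⟩

lemma IsHamiltonian.add_one {H : ℝ → M → ℝ} (hH : IsHamiltonian (n := n) H) (t : ℝ) :
    H (t + 1) = H t := funext fun x => hH.periodic t x

lemma IsHamiltonian.fract {H : ℝ → M → ℝ} (hH : IsHamiltonian (n := n) H) (t : ℝ) :
    H (Int.fract t) = H t := by
  have hp : Function.Periodic H 1 := hH.add_one
  have := hp.sub_int_mul_eq (x := t) ⌊t⌋
  rwa [mul_one] at this

/-- A bound for `dH_t` which is uniform in time, by periodicity. -/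
lemma Tames.exists_dH_le [CompactSpace M] {σ : TwoForm n M} {J : EndField n M}
    (hσ : IsSmoothForm σ) (hJ : IsAlmostComplex J) (ht : Tames σ J)
    {H : ℝ → M → ℝ} (hH : IsHamiltonian (n := n) H) :
    ∃ K : ℝ, 0 ≤ K ∧ ∀ t x, ∀ v : TangentSpace (𝓡 (2 * n)) x,
      |diff (H t) x v| ≤ K * tameNorm σ J x v := by
  obtain ⟨K, hK, h⟩ := exists_uniform_bound_of_isCompact
    ((isCompact_Icc (a := (0 : ℝ)) (b := 1)).prod (isCompact_univ (X := M)))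
    (P := fun K p => ∀ v : TangentSpace (𝓡 (2 * n)) p.2,
      ‖diff (H p.1) p.2 v‖ ≤ K * tameNorm σ J p.2 v)
    (fun a b x hab h v => (h v).trans (by gcongr; exact tameNorm_nonneg ..)) (fun p _ => by
      obtain ⟨K, -, hK⟩ := ht.exists_diff_le hσ hJ (f := H) (t₀ := p.1) (x₀ := p.2)
        hH.smooth.contMDiffAt
      exact ⟨K, hK⟩)
  refine ⟨K, hK, fun t x v => ?_⟩
  have := h (Int.fract t, x) ⟨⟨Int.fract_nonneg t, (Int.fract_lt_one t).le⟩, mem_univ x⟩ v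
  simp only [hH.fract t] at this
  exact this

/-! ### Pointwise bounds for forms and Hamiltonian vector fields -/

lemma abs_linear_le (f : Model n →ₗ[ℝ] ℝ) {C : ℝ}
    (hf : ∀ i, |f (EuclideanSpace.single i 1)| ≤ C) (a : Model n) :
    |f a| ≤ (2 * n) * C * ‖a‖ := by
  have h : a = ∑ i, a i • EuclideanSpace.single i (1 : ℝ) := by
    ext j
    simp [Finset.sum_apply, Pi.single_apply]
  calc |f a| = |∑ i, a i * f (EuclideanSpace.single i 1)| := by
        conv_lhs => rw [h]
        simp
    _ ≤ ∑ i, |a i * f (EuclideanSpace.single i 1)| := Finset.abs_sum_le_sum_abs _ _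
    _ ≤ ∑ i : Fin (2 * n), ‖a‖ * C := by
        refine Finset.sum_le_sum fun i _ => ?_
        rw [abs_mul]
        gcongr
        · exact PiLp.norm_apply_le a i
        · exact hf i
    _ = (2 * n) * C * ‖a‖ := by
        simp
        ring

lemma abs_form_le (Λ : Model n [⋀^Fin 2]→L[ℝ] ℝ) {C : ℝ}
    (hC : ∀ i j, |Λ ![EuclideanSpace.single i 1, EuclideanSpace.single j 1]| ≤ C)
    (a b : Model n) : |Λ ![a, b]| ≤ C * ((2 * n) ^ 2 * ‖a‖ * ‖b‖) := by
  have h1 : ∀ i, |Λ ![EuclideanSpace.single i 1, b]| ≤ (2 * n) * C * ‖b‖ := fun i =>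
    abs_linear_le (IsLinearMap.mk' (fun b => Λ ![EuclideanSpace.single i 1, b])
      ⟨fun x y => form_add_right Λ _ x y, fun c x => form_smul_right Λ c _ x⟩) (hC i) b
  have h2 := abs_linear_le (IsLinearMap.mk' (fun a => Λ ![a, b])
      ⟨fun x y => form_add_left Λ x y b, fun c x => form_smul_left Λ c x b⟩) h1 a
  refine h2.trans (le_of_eq ?_)
  ring

lemma abs_coeff_le (B : BallCover n M) {ε : ℕ → ℝ} (hε : 0 < ε 0) {α : TwoForm n M}
    (hα : epsNorm B ε α ≠ ⊤) (i : Fin B.card) (a b : Fin (2 * n)) {y : Model n}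
    (hy : y ∈ Metric.ball (0 : Model n) 1) :
    |coeff B α i a b y| ≤ (epsNorm B ε α).toReal / ε 0 := by
  have h1 : ‖coeff B α i a b y‖ₑ ≤ kNorm B 0 α := by
    have h0 : ‖coeff B α i a b y‖ₑ = ‖iteratedFDeriv ℝ 0 (coeff B α i a b) y
        (fun j => EuclideanSpace.single ((Fin.elim0 : Fin 0 → Fin (2 * n)) j) 1)‖ₑ := by
      simp
    rw [h0, kNorm]
    exact le_iSup_of_le i (le_iSup_of_le a (le_iSup_of_le b (le_iSup_of_le y
      (le_iSup_of_le hy (le_iSup_of_le (Fin.elim0 : Fin 0 → Fin (2 * n)) le_rfl)))))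
  have h2 : ENNReal.ofReal (ε 0) * ‖coeff B α i a b y‖ₑ ≤ epsNorm B ε α :=
    (mul_le_mul_right h1 _).trans
      (ENNReal.le_tsum (f := fun k => ENNReal.ofReal (ε k) * kNorm B k α) 0)
  have h3 := ENNReal.toReal_mono hα h2
  rw [ENNReal.toReal_mul, ENNReal.toReal_ofReal hε.le, toReal_enorm, Real.norm_eq_abs] at h3
  rw [le_div_iff₀ hε]
  linarith

/-- The `ε`-norm controls a 2-form pointwise with respect to the metric of a tame pair. -/
lemma Tames.exists_form_le [CompactSpace M] (B : BallCover n M) {ε : ℕ → ℝ} (hε : 0 < ε 0)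
    {σ : TwoForm n M} {J : EndField n M} (hσ : IsSmoothForm σ) (hJ : IsAlmostComplex J)
    (ht : Tames σ J) :
    ∃ K : ℝ, 0 ≤ K ∧ ∀ α : TwoForm n M, epsNorm B ε α ≠ ⊤ →
      ∀ x, ∀ v w : TangentSpace (𝓡 (2 * n)) x,
        |α x ![v, w]| ≤ (epsNorm B ε α).toReal * (K * (tameNorm σ J x v * tameNorm σ J x w)) := by
  obtain ⟨K, hK, h⟩ := exists_uniform_bound_of_isCompact (isCompact_univ (X := M))
    (P := fun K x => ∀ α : TwoForm n M, epsNorm B ε α ≠ ⊤ →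
      ∀ v w : TangentSpace (𝓡 (2 * n)) x,
        |α x ![v, w]| ≤ (epsNorm B ε α).toReal * (K * (tameNorm σ J x v * tameNorm σ J x w)))
    (fun a b x hab h α hα v w => (h α hα v w).trans (by
      have h1 := tameNorm_nonneg σ J x v
      have h2 := tameNorm_nonneg σ J x w
      gcongr)) (fun x _ => by
      obtain ⟨i, hi⟩ := mem_iUnion.1 (B.covers ▸ mem_univ x : x ∈ ⋃ i, (B.chart i).source)
      have hφ := B.mem_atlas i
      have hs : ContMDiffAt (𝓡 (2 * n)) 𝓘(ℝ, Model n) ∞ (B.chart i) x :=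
        (contMDiffOn_of_mem_maximalAtlas hφ).contMDiffAt ((B.chart i).open_source.mem_nhds hi)
      obtain ⟨K, hK0, hK⟩ := ht.exists_diff_le hσ hJ (f := fun _ => B.chart i) (t₀ := 0) (x₀ := x)
        (ContMDiffAt.comp (0, x) (g := B.chart i) (f := Prod.snd) hs contMDiffAt_snd)
      have hc : ContinuousAt (fun x : M => ((0 : ℝ), x)) x := by fun_prop
      refine ⟨(2 * n) ^ 2 * K ^ 2 / ε 0, ?_⟩
      filter_upwards [hc.eventually hK, (B.chart i).open_source.mem_nhds hi] with y hy hys α hα v w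
      rw [form_eq_inChart α hφ hys]
      have hb : B.chart i y ∈ Metric.ball (0 : Model n) 1 := by
        rw [← B.target_eq i]
        exact (B.chart i).map_source hys
      refine (abs_form_le _ (fun a b => abs_coeff_le B hε hα i a b hb) _ _).trans ?_
      have hv := hy v
      have hw := hy w
      have hvn := tameNorm_nonneg σ J y v
      calc (epsNorm B ε α).toReal / ε 0 *
            ((2 * n) ^ 2 * ‖diff (B.chart i) y v‖ * ‖diff (B.chart i) y w‖)
          ≤ (epsNorm B ε α).toReal / ε 0 *
            ((2 * n) ^ 2 * (K * tameNorm σ J y v) * (K * tameNorm σ J y w)) := by gcongr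
        _ = _ := by ring)
  exact ⟨K, hK, fun α hα x => h x (mem_univ x) α hα⟩

/-- Tame forms are non-degenerate, so the Hamiltonian vector field solves its equation. -/
lemma Tames.hamVF_spec {σ : TwoForm n M} {J : EndField n M} (ht : Tames σ J) (H : ℝ → M → ℝ)
    (t : ℝ) (x : M) (v : TangentSpace (𝓡 (2 * n)) x) :
    σ x ![v, hamVF σ H t x] = diff (H t) x v := by
  have : FiniteDimensional ℝ (TangentSpace (𝓡 (2 * n)) x) :=
    inferInstanceAs (FiniteDimensional ℝ (Model n))
  have hex : ∃ X : TangentSpace (𝓡 (2 * n)) x, ∀ v : TangentSpace (𝓡 (2 * n)) x,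
      σ x ![v, X] = (mfderiv (𝓡 (2 * n)) 𝓘(ℝ, ℝ) (H t) x : _ →L[ℝ] ℝ) v := by
    let T : TangentSpace (𝓡 (2 * n)) x →ₗ[ℝ] Module.Dual ℝ (TangentSpace (𝓡 (2 * n)) x) :=
      LinearMap.mk₂ ℝ (fun X v => σ x ![v, X])
        (fun a b v => form_add_right (σ x) v a b) (fun c a v => form_smul_right (σ x) c v a)
        (fun a v w => form_add_left (σ x) v w a) (fun c a v => form_smul_left (σ x) c v a)
    have hinj : Function.Injective T := by
      rw [← LinearMap.ker_eq_bot, LinearMap.ker_eq_bot']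
      intro X hX
      by_contra h
      have h1 : σ x ![J x X, X] = 0 := DFunLike.congr_fun hX (J x X)
      have h2 := ht x X h
      rw [form_swap, h1] at h2
      simp at h2
    have hsurj : Function.Surjective T :=
      (LinearMap.injective_iff_surjective_of_finrank_eq_finrank
        Subspace.dual_finrank_eq.symm).1 hinj
    obtain ⟨X, hX⟩ := hsurj
      (diff (H t) x).toLinearMap
    exact ⟨X, fun v => DFunLike.congr_fun hX v⟩
  exact Classical.epsilon_spec hex v

/-- The Hamiltonian vector field of a form `σ` which dominates `ω₀` is bounded in the metric
of `ω₀`. -/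
lemma Tames.tameNorm_hamVF_le {ω₀ σ : TwoForm n M} {J : EndField n M} (hJ : IsAlmostComplex J)
    (hω : Tames ω₀ J) (hσ : Tames σ J) {H : ℝ → M → ℝ} {c K : ℝ} (hc : 0 < c) (hK0 : 0 ≤ K)
    (hdom : ∀ x, ∀ v : TangentSpace (𝓡 (2 * n)) x, c * ω₀ x ![v, J x v] ≤ σ x ![v, J x v])
    (hK : ∀ t x, ∀ v : TangentSpace (𝓡 (2 * n)) x,
      |diff (H t) x v| ≤ K * tameNorm ω₀ J x v) (t : ℝ) (x : M) :
    tameNorm ω₀ J x (hamVF σ H t x) ≤ K / c := by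
  set X := hamVF σ H t x with hX
  -- test the defining equation of `X` with `J X`
  have h1 : c * tameNorm ω₀ J x X ^ 2 ≤ K * tameNorm ω₀ J x X := by
    rw [hω.tameNorm_sq]
    calc c * ω₀ x ![X, J x X] ≤ σ x ![X, J x X] := hdom x X
      _ = -diff (H t) x (J x X) := by rw [form_swap, hσ.hamVF_spec]
      _ ≤ |diff (H t) x (J x X)| := neg_le_abs _
      _ ≤ K * tameNorm ω₀ J x (J x X) := hK _ _ _
      _ = K * tameNorm ω₀ J x X := by rw [tameNorm_J hJ]
  rw [le_div_iff₀ hc]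
  rcases (tameNorm_nonneg ω₀ J x X).eq_or_lt with h | h
  · rw [← h]; simpa using hK0
  · nlinarith

/-- The coordinate expression of the Hamiltonian vector field of a tame form is continuous:
testing its equation with `J d`, where `d` is its increment, bounds `|d|²` by `|d|` times the
increments of the coefficients of `σ` and `dH`. -/
lemma Tames.continuousAt_hamVF_chart {σ : TwoForm n M} {J : EndField n M} (hσ : IsSmoothForm σ)
    (hJ : IsAlmostComplex J) (ht : Tames σ J) {H : ℝ → M → ℝ} (hH : IsHamiltonian (n := n) H)
    (t₀ : ℝ) (x₀ : M) :
    ContinuousAt (fun p : ℝ × M => diff (chartAt (Model n) x₀) p.2 (hamVF σ H p.1 p.2))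
      (t₀, x₀) := by
  set φ := chartAt (Model n) x₀ with hφ
  have hmem := chartAt_mem (n := n) x₀
  have hx₀ : x₀ ∈ φ.source := mem_chart_source _ x₀
  obtain ⟨Jc, hJc, hJ'⟩ := hJ.exists_chart_expression x₀
  obtain ⟨c, hc, hlow⟩ := ht.exists_lower_bound hσ hJ x₀
  obtain ⟨L, hL, hLH⟩ := diff_eq_fderiv_chart (f := H) (t₀ := t₀) hH.smooth.contMDiffAt hmem hx₀
  set e₀ := diff φ x₀ (hamVF σ H t₀ x₀) with he₀
  set Λ : M → Model n [⋀^Fin 2]→L[ℝ] ℝ := fun x => inChart σ φ (φ x) with hω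
  have hΛc : ContinuousAt (fun p : ℝ × M => Λ p.2) (t₀, x₀) :=
    ContinuousAt.comp' (f := Prod.snd) (g := Λ) (continuousAt_inChart hσ hmem hx₀) continuousAt_snd
  have hbase : ∀ e, L t₀ x₀ e = Λ x₀ ![e, e₀] := by
    intro e
    obtain ⟨v, rfl⟩ := exists_diff_eq hmem hx₀ e
    rw [hω, he₀]
    rw [← form_eq_inChart σ hmem hx₀, ht.hamVF_spec]
    exact (hLH.self_of_nhds v).symm
  have hform : ∀ (η : Model n [⋀^Fin 2]→L[ℝ] ℝ) (a b : Model n),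
      |η ![a, b]| ≤ ‖η‖ * (‖a‖ * ‖b‖) := by
    intro η a b
    simpa [Fin.prod_univ_two] using η.le_opNorm ![a, b]
  have hbound : ∀ᶠ p : ℝ × M in 𝓝 (t₀, x₀),
      ‖diff φ p.2 (hamVF σ H p.1 p.2) - e₀‖ ≤
        (‖L p.1 p.2 - L t₀ x₀‖ + ‖Λ p.2 - Λ x₀‖ * ‖e₀‖) * ‖Jc p.2‖ / c := by
    filter_upwards [hLH, continuousAt_snd.eventually hJ', continuousAt_snd.eventually hlow,
      continuousAt_snd.eventually (φ.open_source.mem_nhds hx₀)] with p h1 h2 h3 hp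
    obtain ⟨v₀, hv₀⟩ := exists_diff_eq hmem hp e₀
    set X := hamVF σ H p.1 p.2 with hX
    set d := diff φ p.2 X - e₀ with hd
    have hdv : diff φ p.2 (X - v₀) = d := by rw [map_sub, hv₀]
    set b := Jc p.2 d with hb
    have hq : σ p.2 ![X - v₀, J p.2 (X - v₀)] =
        (Λ p.2 - Λ x₀) ![b, e₀] - (L p.1 p.2 - L t₀ x₀) b := by
      rw [form_swap, form_sub_right, ht.hamVF_spec, h1, form_eq_inChart σ hmem hp, h2, hdv, hv₀,
        ContinuousAlternatingMap.sub_apply, sub_apply, hbase]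
      ring
    have h4 := h3 (X - v₀)
    rw [hdv, hq] at h4
    have h5 : c * ‖d‖ ^ 2 ≤
        (‖L p.1 p.2 - L t₀ x₀‖ + ‖Λ p.2 - Λ x₀‖ * ‖e₀‖) * ‖Jc p.2‖ * ‖d‖ := by
      have i1 := hform (Λ p.2 - Λ x₀) b e₀
      have i2 : |(L p.1 p.2 - L t₀ x₀) b| ≤ ‖L p.1 p.2 - L t₀ x₀‖ * ‖b‖ :=
        (L p.1 p.2 - L t₀ x₀).le_opNorm b
      have i3 : ‖b‖ ≤ ‖Jc p.2‖ * ‖d‖ := (Jc p.2).le_opNorm d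
      calc c * ‖d‖ ^ 2 ≤ _ := h4
        _ ≤ ‖Λ p.2 - Λ x₀‖ * (‖b‖ * ‖e₀‖) + ‖L p.1 p.2 - L t₀ x₀‖ * ‖b‖ := by
            linarith [le_abs_self ((Λ p.2 - Λ x₀) ![b, e₀]),
              neg_le_abs ((L p.1 p.2 - L t₀ x₀) b)]
        _ = (‖L p.1 p.2 - L t₀ x₀‖ + ‖Λ p.2 - Λ x₀‖ * ‖e₀‖) * ‖b‖ := by ring
        _ ≤ (‖L p.1 p.2 - L t₀ x₀‖ + ‖Λ p.2 - Λ x₀‖ * ‖e₀‖) * (‖Jc p.2‖ * ‖d‖) := by gcongr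
        _ = _ := by ring
    rw [le_div_iff₀ hc]
    rcases (norm_nonneg d).eq_or_lt with h | h
    · rw [← h, zero_mul]; positivity
    · nlinarith
  have hlim : Tendsto (fun p : ℝ × M =>
      (‖L p.1 p.2 - L t₀ x₀‖ + ‖Λ p.2 - Λ x₀‖ * ‖e₀‖) * ‖Jc p.2‖ / c) (𝓝 (t₀, x₀)) (𝓝 0) := by
    have hJc' : ContinuousAt (fun p : ℝ × M => Jc p.2) (t₀, x₀) :=
      ContinuousAt.comp' (f := Prod.snd) (g := Jc) hJc continuousAt_snd
    have := (((hL.sub (continuousAt_const (y := L t₀ x₀))).norm.add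
      ((hΛc.sub (continuousAt_const (y := Λ x₀))).norm.mul (continuousAt_const (y := ‖e₀‖)))).mul
        hJc'.norm).div_const c
    simpa [ContinuousAt] using this
  rw [ContinuousAt, tendsto_iff_norm_sub_tendsto_zero]
  exact squeeze_zero' (Eventually.of_forall fun _ => norm_nonneg _) hbound hlim

/-- The derivative of a smooth map along the Hamiltonian vector field is continuous. -/
lemma Tames.continuous_diff_hamVF {σ : TwoForm n M} {J : EndField n M} (hσ : IsSmoothForm σ)
    (hJ : IsAlmostComplex J) (ht : Tames σ J) {H : ℝ → M → ℝ} (hH : IsHamiltonian (n := n) H)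
    {E' : Type*} [NormedAddCommGroup E'] [NormedSpace ℝ E'] {g : M → E'}
    (hg : ContMDiff (𝓡 (2 * n)) 𝓘(ℝ, E') ∞ g) :
    Continuous (fun p : ℝ × M => diff g p.2 (hamVF σ H p.1 p.2)) := by
  rw [continuous_iff_continuousAt]
  rintro ⟨t₀, x₀⟩
  obtain ⟨L, hL, hLg⟩ := diff_eq_fderiv_chart (f := fun _ => g) (t₀ := t₀) (x₀ := x₀)
    (hg.comp contMDiff_snd).contMDiffAt (chartAt_mem (n := n) x₀) (mem_chart_source _ x₀)
  refine (hL.clm_apply (ht.continuousAt_hamVF_chart hσ hJ hH t₀ x₀)).congr ?_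
  filter_upwards [hLg] with p hp
  exact (hp _).symm

/-! ### Almost periodic orbits -/

lemma hasDerivAt_comp_curve {E' : Type*} [NormedAddCommGroup E'] [NormedSpace ℝ E'] {g : M → E'}
    (hg : ContMDiff (𝓡 (2 * n)) 𝓘(ℝ, E') ∞ g) {x : ℝ → M} {t : ℝ}
    {x' : TangentSpace (𝓡 (2 * n)) (x t)}
    (hx : HasMFDerivAt 𝓘(ℝ, ℝ) (𝓡 (2 * n)) x t ((1 : ℝ →L[ℝ] ℝ).smulRight x')) :
    HasDerivAt (fun t => g (x t)) (diff g (x t) x') t := by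
  have h1 : HasMFDerivAt (𝓡 (2 * n)) 𝓘(ℝ, E') g (x t) (diff g (x t)) :=
    ((hg.mdifferentiable (by simp)) (x t)).hasMFDerivAt
  have h2 : HasFDerivAt (fun t => g (x t))
      ((diff g (x t)).comp ((1 : ℝ →L[ℝ] ℝ).smulRight x') : ℝ →L[ℝ] E') t :=
    (HasMFDerivAt.comp t h1 hx).hasFDerivAt
  have e : ((diff g (x t)).comp ((1 : ℝ →L[ℝ] ℝ).smulRight x') : ℝ →L[ℝ] E') 1 =
      diff g (x t) x' :=
    congrArg (diff g (x t)) (one_smul ℝ x')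
  rw [← e]
  exact h2.hasDerivAt

/-- A continuous curve is differentiable if its expression in the chart at the point is. -/
lemma hasMFDerivAt_of_chart {x : ℝ → M} {t : ℝ} (hc : ContinuousAt x t)
    {v : TangentSpace (𝓡 (2 * n)) (x t)}
    (h : HasDerivAt (fun s => chartAt (Model n) (x t) (x s)) (diff (chartAt (Model n) (x t)) (x t) v)
      t) :
    HasMFDerivAt 𝓘(ℝ, ℝ) (𝓡 (2 * n)) x t ((1 : ℝ →L[ℝ] ℝ).smulRight v) := by
  set φ := chartAt (Model n) (x t) with hφ
  have hmem := chartAt_mem (n := n) (x t)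
  have hs : x t ∈ φ.source := mem_chart_source _ _
  have h1 : HasMFDerivAt 𝓘(ℝ, Model n) (𝓡 (2 * n)) φ.symm (φ (x t))
      (mfderiv 𝓘(ℝ, Model n) (𝓡 (2 * n)) φ.symm (φ (x t))) :=
    ((chart_mdifferentiable hmem).symm.mdifferentiableAt (φ.map_source hs)).hasMFDerivAt
  have h2 := HasMFDerivAt.comp t h1 h.hasFDerivAt.hasMFDerivAt
  have h3 := h2.congr_of_eventuallyEq (f₁ := x) (by
    filter_upwards [hc.eventually (φ.open_source.mem_nhds hs)] with s hs
    exact (φ.left_inv hs).symm)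
  have e : (1 : ℝ →L[ℝ] ℝ).smulRight v =
      ((mfderiv 𝓘(ℝ, Model n) (𝓡 (2 * n)) φ.symm (φ (x t)) : Model n →L[ℝ] Model n).comp
        (ContinuousLinearMap.toSpanSingleton ℝ (diff φ (x t) v)) : ℝ →L[ℝ] Model n) := by
    refine ContinuousLinearMap.ext_ring ?_
    refine (one_smul ℝ v).trans ((symm_diff_apply hmem hs v).symm.trans ?_)
    exact congrArg (mfderiv 𝓘(ℝ, Model n) (𝓡 (2 * n)) φ.symm (φ (x t)) : Model n →L[ℝ] Model n)
      (one_smul ℝ (diff φ (x t) v)).symm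
  exact e ▸ h3

/-- `x` is a loop with velocity `x'` whose deviation `|x' - X_H^σ|` from Hamilton's equation is at
most `√q`, for a continuous 1-periodic function `q`. The velocity and the bound `q` are data, so
that no regularity of `x'` is needed. -/
structure IsAlmostOrbit (σ : TwoForm n M) (J : EndField n M) (H : ℝ → M → ℝ) (q : ℝ → ℝ)
    (x : ℝ → M) (x' : ∀ t, TangentSpace (𝓡 (2 * n)) (x t)) : Prop where
  deriv : ∀ t, HasMFDerivAt 𝓘(ℝ, ℝ) (𝓡 (2 * n)) x t ((1 : ℝ →L[ℝ] ℝ).smulRight (x' t))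
  periodic : ∀ t, x (t + 1) = x t
  continuous : Continuous q
  periodic_density : ∀ t, q (t + 1) = q t
  le : ∀ t, tameNorm σ J (x t) (x' t - hamVF σ H t (x t)) ^ 2 ≤ q t

/-- Weighted arithmetic-geometric mean inequality; it replaces the Cauchy-Schwarz inequality for
integrals of `√q`. -/
lemma sqrt_le_weighted {a q η : ℝ} (hη : 0 < η) (h : a ^ 2 ≤ q) : a ≤ (q / η + η) / 2 := by
  have : a ^ 2 / η + η - 2 * a = (a - η) ^ 2 / η := by field_simp; ring
  have h2 : 0 ≤ (a - η) ^ 2 / η := by positivity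
  have h3 : a ^ 2 / η ≤ q / η := by gcongr
  linarith

/-- Along an almost orbit, a function `g` whose derivative along the Hamiltonian vector field is
`D`-close to `h₀` is `D |b - a|`-close to the affine function of slope `h₀`, up to an error which
tends to zero with the deviation. -/
lemma IsAlmostOrbit.norm_sub_le {σ : TwoForm n M} {J : EndField n M} {H : ℝ → M → ℝ} {q : ℝ → ℝ}
    {x : ℝ → M} {x' : ∀ t, TangentSpace (𝓡 (2 * n)) (x t)} (h : IsAlmostOrbit σ J H q x x')
    {E' : Type*} [NormedAddCommGroup E'] [NormedSpace ℝ E'] {g : M → E'}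
    (hg : ContMDiff (𝓡 (2 * n)) 𝓘(ℝ, E') ∞ g) {K : ℝ} (hK0 : 0 ≤ K)
    (hK : ∀ x, ∀ v : TangentSpace (𝓡 (2 * n)) x, ‖diff g x v‖ ≤ K * tameNorm σ J x v)
    {η : ℝ} (hη : 0 < η) (hq : ∫ t in (0 : ℝ)..1, q t ≤ η ^ 2) {a b : ℝ} (hab : |b - a| ≤ 1)
    {h₀ : E'} {D : ℝ}
    (hD : ∀ t ∈ uIcc a b, ‖diff g (x t) (hamVF σ H t (x t)) - h₀‖ ≤ D) :
    ‖g (x b) - g (x a) - (b - a) • h₀‖ ≤ D * |b - a| + K * η := by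
  wlog hle : a ≤ b generalizing a b
  · have := this (a := b) (b := a) (by rwa [abs_sub_comm]) (by rwa [uIcc_comm]) (le_of_not_ge hle)
    have e : g (x b) - g (x a) - (b - a) • h₀ = -(g (x a) - g (x b) - (a - b) • h₀) := by
      rw [← neg_sub b a, neg_smul]; abel
    rwa [abs_sub_comm, e, norm_neg]
  rw [uIcc_of_le hle] at hD
  rw [abs_of_nonneg (sub_nonneg.2 hle)] at hab ⊢
  have hq0 : ∀ t, 0 ≤ q t := fun t => (sq_nonneg _).trans (h.le t)
  set ψ : ℝ → E' := fun t => g (x t) - (t - a) • h₀ with hψ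
  have hψd : ∀ t, HasDerivAt ψ (diff g (x t) (x' t) - h₀) t := by
    intro t
    have h1 := hasDerivAt_comp_curve hg (h.deriv t)
    have h2 := ((hasDerivAt_id t).sub_const a).smul_const h₀
    rw [one_smul] at h2
    exact h1.sub h2
  set P : ℝ → ℝ := fun t => D + K * ((q t / η + η) / 2) with hP
  have hPc : Continuous P := by
    have := h.continuous
    fun_prop
  have hbound : ∀ t ∈ Ico a b, ‖diff g (x t) (x' t) - h₀‖ ≤ P t := by
    intro t ht
    have e : diff g (x t) (x' t) - h₀ = (diff g (x t) (hamVF σ H t (x t)) - h₀) +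
        diff g (x t) (x' t - hamVF σ H t (x t)) := by
      rw [map_sub]; abel
    rw [e]
    refine (norm_add_le _ _).trans (add_le_add (hD t ⟨ht.1, ht.2.le⟩) ?_)
    refine (hK _ _).trans ?_
    gcongr
    exact sqrt_le_weighted hη (h.le t)
  have main : ‖ψ b - ψ a‖ ≤ ∫ t in a..b, P t :=
    norm_sub_le_integral_of_norm_deriv_le_of_le hle
      (fun t _ => (hψd t).continuousAt.continuousWithinAt)
      (fun t _ => (hψd t).differentiableAt.differentiableWithinAt)
      (Eventually.of_forall fun t ht => by
        rw [(hψd t).deriv]; exact hbound t (Ioo_subset_Ico_self ht))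
      (hPc.intervalIntegrable _ _)
  have e1 : ψ b - ψ a = g (x b) - g (x a) - (b - a) • h₀ := by
    simp only [hψ, sub_self, zero_smul, sub_zero]; abel
  rw [e1] at main
  refine main.trans ?_
  have hi : ∀ c d, IntervalIntegrable (fun t => (q t / η + η) / 2) volume c d := fun c d =>
    (((h.continuous.div_const _).add_const _).div_const _).intervalIntegrable _ _
  have e2 : ∫ τ in a..b, P τ = D * (b - a) + K * ∫ t in a..b, (q t / η + η) / 2 := by
    rw [hP, intervalIntegral.integral_add (by simp) ((hi a b).const_mul K)]
    simp [mul_comm]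
  have e3 : ∫ t in a..b, (q t / η + η) / 2 ≤ ∫ t in a..(a + 1), (q t / η + η) / 2 := by
    refine intervalIntegral.integral_mono_interval le_rfl hle (by linarith) ?_ (hi _ _)
    filter_upwards with t
    have := hq0 t
    simp only [Pi.zero_apply]
    positivity
  have e4 : ∫ t in a..(a + 1), (q t / η + η) / 2 = ((∫ t in (0 : ℝ)..1, q t) / η + η) / 2 := by
    have hper : Function.Periodic q 1 := h.periodic_density
    have := hper.intervalIntegral_add_eq a 0
    rw [zero_add] at this
    rw [intervalIntegral.integral_div, intervalIntegral.integral_add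
      ((h.continuous.div_const _).intervalIntegrable _ _) (by simp), intervalIntegral.integral_div,
      this]
    simp
  have e5 : (∫ t in (0 : ℝ)..1, q t) / η ≤ η := by
    rw [div_le_iff₀ hη]; linarith
  rw [e2]
  gcongr
  linarith

lemma exists_tendsto_ultrafilter {X ι : Type*} [TopologicalSpace X] [CompactSpace X]
    (𝒰 : Ultrafilter ι) (f : ι → X) : ∃ y, Tendsto f 𝒰 (𝓝 y) := by
  obtain ⟨y, -, hy⟩ := isCompact_univ.ultrafilter_le_nhds (𝒰.map f) (by simp)
  exact ⟨y, hy⟩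

/-- Loops which almost satisfy Hamilton's equation stay close to the periodic orbits, hence,
together with a neighbourhood of fixed size, in every open set that contains these orbits.
Otherwise a sequence of loops with deviation tending to zero and with points outside the open set
exists; its pointwise limit along an ultrafilter is a periodic orbit, and it has a point outside
the open set. -/
lemma Tames.exists_almostOrbit_subset [T2Space M] [CompactSpace M] {σ : TwoForm n M}
    {J : EndField n M} (hσ : IsSmoothForm σ) (hJ : IsAlmostComplex J) (ht : Tames σ J)
    {H : ℝ → M → ℝ} (hH : IsHamiltonian (n := n) H) {U : Set M} (hU : IsOpen U)
    (horbits : ∀ x, IsPeriodicOrbit σ H x → range x ⊆ U)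
    {E' : Type*} [NormedAddCommGroup E'] [NormedSpace ℝ E'] {F : M → E'}
    (hF : ContMDiff (𝓡 (2 * n)) 𝓘(ℝ, E') ∞ F) (hFe : IsEmbedding F) :
    ∃ N r : ℝ, 0 < N ∧ 0 < r ∧ ∀ q x x', IsAlmostOrbit σ J H q x x' →
      ∫ t in (0 : ℝ)..1, q t ≤ N → ∀ t p, ‖F p - F (x t)‖ < r → p ∈ U := by
  by_contra! hcon
  have hseq : ∀ k : ℕ, ∃ q x x', IsAlmostOrbit σ J H q x x' ∧
      ∫ t in (0 : ℝ)..1, q t ≤ (1 / ((k : ℝ) + 1)) ^ 2 ∧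
      ∃ t p, ‖F p - F (x t)‖ < 1 / ((k : ℝ) + 1) ∧ p ∉ U := fun k =>
    hcon ((1 / ((k : ℝ) + 1)) ^ 2) (1 / ((k : ℝ) + 1)) (by positivity) (by positivity)
  choose q x x' hx hq t p htp hpU using hseq
  set η : ℕ → ℝ := fun k => 1 / ((k : ℝ) + 1) with hη
  have hη0 : ∀ k, 0 < η k := fun k => by simp only [hη]; positivity
  set 𝒰 : Ultrafilter ℕ := hyperfilter ℕ
  have hηlim : Tendsto η 𝒰 (𝓝 0) :=
    tendsto_one_div_add_atTop_nhds_zero_nat.mono_left Nat.hyperfilter_le_atTop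
  choose y hy using fun s => exists_tendsto_ultrafilter 𝒰 (fun k => x k s)
  obtain ⟨KH, hKH0, hKH⟩ := ht.exists_dH_le hσ hJ hH
  have hX : ∀ s p, tameNorm σ J p (hamVF σ H s p) ≤ KH := fun s p => by
    simpa using ht.tameNorm_hamVF_le hJ ht one_pos hKH0 (fun x v => by simp) hKH s p
  obtain ⟨KF, hKF0, hKF⟩ := ht.exists_diff_le_global hσ hJ hF
  -- almost equicontinuity of the sequence
  have hequi : ∀ k a b, |b - a| ≤ 1 →
      ‖F (x k b) - F (x k a)‖ ≤ KF * KH * |b - a| + KF * η k := by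
    intro k a b hab
    have := (hx k).norm_sub_le hF hKF0 hKF (hη0 k) (hq k) hab (h₀ := 0) (D := KF * KH) (by
      intro s _
      rw [sub_zero]
      exact (hKF _ _).trans (by gcongr; exact hX _ _))
    simpa using this
  have hequi' : ∀ a b, |b - a| ≤ 1 → ‖F (y b) - F (y a)‖ ≤ KF * KH * |b - a| := by
    intro a b hab
    have h1 : Tendsto (fun k => ‖F (x k b) - F (x k a)‖) 𝒰 (𝓝 ‖F (y b) - F (y a)‖) :=
      (((hF.continuous.tendsto _).comp (hy b)).sub ((hF.continuous.tendsto _).comp (hy a))).norm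
    have h2 : Tendsto (fun k => KF * KH * |b - a| + KF * η k) 𝒰 (𝓝 (KF * KH * |b - a| + KF * 0)) :=
      (hηlim.const_mul _).const_add _
    rw [mul_zero, add_zero] at h2
    exact le_of_tendsto_of_tendsto' h1 h2 fun k => hequi k a b hab
  have hyc : ∀ s, ContinuousAt y s := by
    intro s
    rw [hFe.isInducing.continuousAt_iff, ContinuousAt, tendsto_iff_norm_sub_tendsto_zero]
    have h1 : ∀ᶠ b in 𝓝 s, ‖(F ∘ y) b - (F ∘ y) s‖ ≤ KF * KH * |b - s| := by
      filter_upwards [Metric.ball_mem_nhds s one_pos] with b hb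
      exact hequi' s b (by rw [Metric.mem_ball, Real.dist_eq] at hb; exact hb.le)
    have h2 : Tendsto (fun b => KF * KH * |b - s|) (𝓝 s) (𝓝 0) := by
      have : Continuous (fun b : ℝ => KF * KH * |b - s|) := by fun_prop
      simpa using this.tendsto s
    exact squeeze_zero' (Eventually.of_forall fun _ => norm_nonneg _) h1 h2
  have hnhds : ∀ (c : M) (V : Set M), V ∈ 𝓝 c → ∃ ρ > 0, ∀ p, ‖F p - F c‖ < ρ → p ∈ V := by
    intro c V hV
    rw [hFe.isInducing.nhds_eq_comap] at hV
    obtain ⟨W, hW, hWV⟩ := hV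
    obtain ⟨ρ, hρ, hρW⟩ := Metric.mem_nhds_iff.1 hW
    exact ⟨ρ, hρ, fun p hp => hWV (hρW (by rwa [Metric.mem_ball, dist_eq_norm]))⟩
  have horb : IsPeriodicOrbit σ H y := by
    refine ⟨fun s => hasMFDerivAt_of_chart (hyc s) ?_, fun s => ?_⟩
    · set c := y s with hc
      set φ := chartAt (Model n) c with hφ
      obtain ⟨f⟩ : Nonempty (SmoothBumpFunction (𝓡 (2 * n)) c) := inferInstance
      -- `g` is the chart at `c`, cut off away from `c`
      set g : M → Model n := fun z => f z • φ z with hg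
      have hgs : ContMDiff (𝓡 (2 * n)) 𝓘(ℝ, Model n) ∞ g :=
        f.contMDiff_smul (contMDiffOn_of_mem_maximalAtlas (chartAt_mem c))
      have hgφ : g =ᶠ[𝓝 c] φ := by
        filter_upwards [f.eventuallyEq_one] with z hz
        simp [hg, hz]
      obtain ⟨Kg, hKg0, hKg⟩ := ht.exists_diff_le_global hσ hJ hgs
      set h₀ := diff g c (hamVF σ H s c) with hh₀
      have hh₀' : diff φ c (hamVF σ H s c) = h₀ := by
        have : mfderiv (𝓡 (2 * n)) 𝓘(ℝ, Model n) g c = mfderiv (𝓡 (2 * n)) 𝓘(ℝ, Model n) φ c :=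
          hgφ.mfderiv_eq
        exact (DFunLike.congr_fun this _).symm
      rw [hh₀']
      have hgd : HasDerivAt (fun s => g (y s)) h₀ s := by
        rw [hasDerivAt_iff_isLittleO, Asymptotics.isLittleO_iff]
        intro D hD
        have hcont := (ht.continuous_diff_hamVF hσ hJ hH hgs).continuousAt (x := (s, c))
        have hnear := Metric.tendsto_nhds.1 hcont D hD
        rw [nhds_prod_eq] at hnear
        obtain ⟨V₁, hV₁, V₂, hV₂, hV⟩ := mem_prod_iff.1 hnear
        obtain ⟨ρ₁, hρ₁, hρV⟩ := Metric.mem_nhds_iff.1 hV₁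
        obtain ⟨ρ₂, hρ₂, hρ₂V⟩ := hnhds c V₂ hV₂
        have hlip : ∀ᶠ b in 𝓝 s, KF * KH * |b - s| < ρ₂ / 3 := by
          have : Continuous (fun b : ℝ => KF * KH * |b - s|) := by fun_prop
          exact (this.tendsto s).eventually (gt_mem_nhds (by simp; positivity))
        filter_upwards [Metric.ball_mem_nhds s one_pos, Metric.ball_mem_nhds s hρ₁, hlip]
          with b hb1 hb2 hb3
        rw [Metric.mem_ball, Real.dist_eq] at hb1 hb2
        have hev : ∀ᶠ k in (𝒰 : Filter ℕ), ‖g (x k b) - g (x k s) - (b - s) • h₀‖ ≤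
            D * |b - s| + Kg * η k := by
          have h1 : ∀ᶠ k in (𝒰 : Filter ℕ), ‖F (x k s) - F c‖ < ρ₂ / 3 := by
            have : Tendsto (fun k => F (x k s)) 𝒰 (𝓝 (F c)) := (hF.continuous.tendsto _).comp (hy s)
            filter_upwards [Metric.tendsto_nhds.1 this (ρ₂ / 3) (by positivity)] with k hk
            rwa [dist_eq_norm] at hk
          have h2 : ∀ᶠ k in (𝒰 : Filter ℕ), KF * η k < ρ₂ / 3 := by
            have := hηlim.const_mul KF
            rw [mul_zero] at this
            exact this.eventually (gt_mem_nhds (by positivity))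
          filter_upwards [h1, h2] with k hk1 hk2
          refine (hx k).norm_sub_le hgs hKg0 hKg (hη0 k) (hq k) hb1.le fun τ hτ => ?_
          have hτs : |τ - s| ≤ |b - s| := by
            exact abs_sub_left_of_mem_uIcc hτ
          have hFτ : ‖F (x k τ) - F c‖ < ρ₂ := by
            calc ‖F (x k τ) - F c‖ ≤ ‖F (x k τ) - F (x k s)‖ + ‖F (x k s) - F c‖ :=
                  norm_sub_le_norm_sub_add_norm_sub _ _ _
              _ ≤ (KF * KH * |τ - s| + KF * η k) + ‖F (x k s) - F c‖ := by
                  gcongr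
                  exact hequi k s τ (hτs.trans hb1.le)
              _ ≤ (KF * KH * |b - s| + KF * η k) + ‖F (x k s) - F c‖ := by gcongr
              _ < ρ₂ := by linarith
          have := hV (show (τ, x k τ) ∈ V₁ ×ˢ V₂ from
            ⟨hρV (by rw [Metric.mem_ball, Real.dist_eq]; linarith), hρ₂V _ hFτ⟩)
          rw [← dist_eq_norm]
          exact le_of_lt this
        have hgc := hgs.continuous
        have l1 : Tendsto (fun k => ‖g (x k b) - g (x k s) - (b - s) • h₀‖) 𝒰
            (𝓝 ‖g (y b) - g c - (b - s) • h₀‖) :=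
          ((((hgc.tendsto _).comp (hy b)).sub ((hgc.tendsto _).comp (hy s))).sub_const _).norm
        have l2 : Tendsto (fun k => D * |b - s| + Kg * η k) 𝒰 (𝓝 (D * |b - s| + Kg * 0)) :=
          (hηlim.const_mul _).const_add _
        rw [mul_zero, add_zero] at l2
        exact le_of_tendsto_of_tendsto l1 l2 hev
      refine hgd.congr_of_eventuallyEq ?_
      filter_upwards [(hyc s).eventually hgφ] with b hb
      exact hb.symm
    · refine tendsto_nhds_unique (hy (s + 1)) ?_
      simpa only [(hx _).periodic s] using hy s
  -- the points `p k ∉ U` converge to a point of the limit orbit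
  have hfr : ∀ k, x k (Int.fract (t k)) = x k (t k) := by
    intro k
    have hp : Function.Periodic (x k) 1 := (hx k).periodic
    have := hp.sub_int_mul_eq (x := t k) ⌊t k⌋
    rwa [mul_one] at this
  obtain ⟨τ, hτ⟩ := exists_tendsto_ultrafilter 𝒰 (fun k =>
    (⟨Int.fract (t k), Int.fract_nonneg _, (Int.fract_lt_one _).le⟩ : Icc (0 : ℝ) 1))
  have hτ' : Tendsto (fun k => Int.fract (t k)) 𝒰 (𝓝 (τ : ℝ)) :=
    (continuous_subtype_val.tendsto τ).comp hτ
  have hlim : Tendsto (fun k => ‖F (p k) - F (y τ)‖) 𝒰 (𝓝 0) := by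
    have hb : ∀ k, ‖F (p k) - F (y τ)‖ ≤ η k + (KF * KH * |Int.fract (t k) - τ| + KF * η k) +
        ‖F (x k τ) - F (y τ)‖ := by
      intro k
      have h1 := htp k
      have h2 := hequi k τ (Int.fract (t k)) (by
        rw [abs_le]
        constructor <;> linarith [Int.fract_nonneg (t k), Int.fract_lt_one (t k), τ.2.1, τ.2.2])
      rw [hfr] at h2
      have e : F (p k) - F (y τ) = (F (p k) - F (x k (t k))) + (F (x k (t k)) - F (x k τ)) +
          (F (x k τ) - F (y τ)) := by abel
      rw [e]
      refine (norm_add_le _ _).trans (add_le_add ((norm_add_le _ _).trans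
        (add_le_add h1.le h2)) le_rfl)
    have l1 : Tendsto (fun k => ‖F (x k τ) - F (y τ)‖) 𝒰 (𝓝 0) :=
      tendsto_iff_norm_sub_tendsto_zero.1 ((hF.continuous.tendsto _).comp (hy τ))
    have l2 : Tendsto (fun k => |Int.fract (t k) - τ|) 𝒰 (𝓝 0) := by
      simpa using (hτ'.sub_const (τ : ℝ)).abs
    have l3 := (hηlim.add ((l2.const_mul (KF * KH)).add (hηlim.const_mul KF))).add l1
    simp only [mul_zero, add_zero] at l3
    exact squeeze_zero (fun _ => norm_nonneg _) hb l3
  obtain ⟨ρ, hρ, hρU⟩ := hnhds (y τ) U (hU.mem_nhds (horbits y horb ⟨τ, rfl⟩))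
  obtain ⟨k, hk⟩ := (hlim.eventually (gt_mem_nhds hρ)).exists
  exact hpU k (hρU _ hk)

/-! ### Rescaling perturbations -/

lemma inChart_smul (c : ℝ) (α : TwoForm n M) (φ : OpenPartialHomeomorph M (Model n)) :
    inChart (c • α) φ = c • inChart α φ := rfl

lemma coeff_smul (B : BallCover n M) (c : ℝ) (α : TwoForm n M) (i : Fin B.card)
    (a b : Fin (2 * n)) : coeff B (c • α) i a b = c • coeff B α i a b := rfl

lemma IsSmoothForm.smul {α : TwoForm n M} (hα : IsSmoothForm α) (c : ℝ) :
    IsSmoothForm (c • α) := fun φ hφ => (hα φ hφ).const_smul c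

lemma IsClosedForm.smul {α : TwoForm n M} (hα : IsClosedForm α) (c : ℝ) :
    IsClosedForm (c • α) := fun φ hφ y hy => by
  rw [inChart_smul, extDeriv_smul, hα φ hφ y hy, smul_zero]

lemma kNorm_smul_le (B : BallCover n M) {α : TwoForm n M} (hα : IsSmoothForm α) (c : ℝ) (k : ℕ) :
    kNorm B k (c • α) ≤ ‖c‖ₑ * kNorm B k α := by
  refine iSup_le fun i => iSup_le fun a => iSup_le fun b => iSup_le fun y => iSup_le fun hy =>
    iSup_le fun l => ?_
  have hs : ContDiffOn ℝ ∞ (coeff B α i a b) (B.chart i).target := by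
    have h := hα _ (B.mem_atlas i)
    let T : (Model n [⋀^Fin 2]→L[ℝ] ℝ) →L[ℝ] ℝ :=
      ContinuousAlternatingMap.apply ℝ (Model n) ℝ
        ![EuclideanSpace.single a 1, EuclideanSpace.single b 1]
    exact T.contDiff.comp_contDiffOn h
  have hat : ContDiffAt ℝ k (coeff B α i a b) y := by
    refine (hs.contDiffAt ((B.chart i).open_target.mem_nhds ?_)).of_le (by exact_mod_cast le_top)
    rwa [B.target_eq i]
  rw [coeff_smul, iteratedFDeriv_const_smul_apply hat, smul_apply,
    enorm_smul]
  gcongr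
  exact le_iSup_of_le i (le_iSup_of_le a (le_iSup_of_le b (le_iSup_of_le y
    (le_iSup_of_le hy (le_iSup (fun l : Fin k → Fin (2 * n) =>
      ‖iteratedFDeriv ℝ k (coeff B α i a b) y (fun j => EuclideanSpace.single (l j) 1)‖ₑ) l)))))

lemma epsNorm_smul_le (B : BallCover n M) (ε : ℕ → ℝ) {α : TwoForm n M} (hα : IsSmoothForm α)
    (c : ℝ) : epsNorm B ε (c • α) ≤ ‖c‖ₑ * epsNorm B ε α := by
  rw [epsNorm, epsNorm, ← ENNReal.tsum_mul_left]
  refine ENNReal.tsum_le_tsum fun k => ?_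
  rw [mul_left_comm]
  gcongr
  exact kNorm_smul_le B hα c k

lemma IsPerturbation.smul {B : BallCover n M} {ε : ℕ → ℝ} {ω₀ : TwoForm n M} {H : ℝ → M → ℝ}
    {δ δ₁ : ℝ} {α : TwoForm n M} (h : IsPerturbation B ε ω₀ H δ α) {c : ℝ} (hc : 0 ≤ c)
    (hcδ : c * δ ≤ δ₁) : IsPerturbation B ε ω₀ H δ₁ (c • α) where
  smooth := h.smooth.smul c
  closed := h.closed.smul c
  vanishes x hx := (h.vanishes x hx).mono fun y hy => by
    rw [Pi.smul_apply, hy, smul_zero]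
  norm_le := by
    refine (epsNorm_smul_le B ε h.smooth c).trans ?_
    refine (mul_le_mul_right h.norm_le _).trans ?_
    rw [Real.enorm_eq_ofReal hc, ← ENNReal.ofReal_mul hc]
    exact ENNReal.ofReal_le_ofReal hcδ

/-- Uniform comparison of the metrics: rescaling a perturbation of size `δ` to size `δ₁` keeps
tameness, so on the smaller class a fixed part of the unperturbed metric survives. -/
lemma IsPerturbation.tame_interp {J : EndField n M} {B : BallCover n M} {ε : ℕ → ℝ}
    {ω₀ : TwoForm n M} {H : ℝ → M → ℝ} {δ δ₁ : ℝ} (hδ : 0 < δ) (hδ₁ : δ < δ₁)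
    (htame : ∀ β, IsPerturbation B ε ω₀ H δ₁ β → Tames (ω₀ + β) J) {α : TwoForm n M}
    (h : IsPerturbation B ε ω₀ H δ α) {c : ℝ} (hc : c ∈ Icc (0 : ℝ) 1) :
    Tames (ω₀ + c • α) J ∧ ∀ x, ∀ v : TangentSpace (𝓡 (2 * n)) x,
      (1 - δ / δ₁) * ω₀ x ![v, J x v] ≤ (ω₀ + c • α) x ![v, J x v] := by
  have hδ₁0 : 0 < δ₁ := hδ.trans hδ₁
  refine ⟨htame _ (h.smul hc.1 ?_), fun x v => ?_⟩
  · nlinarith [hc.1, hc.2]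
  · have ht := htame _ (h.smul (c := δ₁ / δ * c) (δ₁ := δ₁)
      (mul_nonneg (by positivity) hc.1) (by
        rw [div_mul_eq_mul_div, div_mul_cancel₀ _ hδ.ne']
        nlinarith [hc.1, hc.2]))
    have h1 := ht.nonneg x v
    have e1 : (ω₀ + (δ₁ / δ * c) • α) x ![v, J x v] =
        ω₀ x ![v, J x v] + δ₁ / δ * c * α x ![v, J x v] := rfl
    have e2 : (ω₀ + c • α) x ![v, J x v] = ω₀ x ![v, J x v] + c * α x ![v, J x v] := rfl
    rw [e1] at h1
    rw [e2]
    have h2 := mul_nonneg (show 0 ≤ δ / δ₁ by positivity) h1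
    have e3 : δ / δ₁ * (ω₀ x ![v, J x v] + δ₁ / δ * c * α x ![v, J x v]) =
        δ / δ₁ * ω₀ x ![v, J x v] + c * α x ![v, J x v] := by
      field_simp
    rw [e3] at h2
    linarith

lemma IsPerturbation.zero_mem {B : BallCover n M} {ε : ℕ → ℝ} {ω₀ : TwoForm n M} {H : ℝ → M → ℝ}
    {δ : ℝ} : IsPerturbation B ε ω₀ H δ 0 where
  smooth φ _ := by
    have : inChart (0 : TwoForm n M) φ = 0 := rfl
    rw [this]; exact contDiffOn_const
  closed φ _ y _ := by
    have : inChart (0 : TwoForm n M) φ = (0 : ℝ) • inChart (0 : TwoForm n M) φ :=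
      (zero_smul ℝ _).symm
    rw [this, extDeriv_smul, zero_smul]
  vanishes x _ := Eventually.of_forall fun y => rfl
  norm_le := by
    have : ∀ k, kNorm B k (0 : TwoForm n M) = 0 := by
      intro k
      have e : ∀ i a b, coeff B (0 : TwoForm n M) i a b = 0 := fun i a b => rfl
      simp [kNorm, e]
    simp [epsNorm, this]

lemma IsCutoff.mem_Icc {κ : ℝ → ℝ} (hκ : IsCutoff κ) (s : ℝ) : κ s ∈ Icc (0 : ℝ) 1 := by
  have hm : StrictMonoOn κ (Icc 0 1) := by
    refine strictMonoOn_of_deriv_pos (convex_Icc 0 1) hκ.smooth.continuous.continuousOn ?_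
    rw [interior_Icc]
    exact hκ.deriv_pos
  have h0 := hκ.eq_zero 0 le_rfl
  have h1 := hκ.eq_one 1 le_rfl
  rcases le_or_gt s 0 with hs | hs
  · simp [hκ.eq_zero s hs]
  rcases le_or_gt 1 s with hs1 | hs1
  · simp [hκ.eq_one s hs1]
  have hmem : s ∈ Icc (0 : ℝ) 1 := ⟨hs.le, hs1.le⟩
  constructor
  · rw [← h0]; exact hm.monotoneOn (by simp) hmem hs.le
  · rw [← h1]; exact hm.monotoneOn hmem (by simp) hs1.le

/-! ### Pull-backs of 2-forms -/

/-- The coefficients of the pull-back of a smooth 2-form by a smooth map are continuous, also up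
to the boundary of the domain. -/
lemma continuousOn_pullback {σ : TwoForm n M} (hσ : IsSmoothForm σ)
    {V : Type*} [NormedAddCommGroup V] [NormedSpace ℝ V] {f : V → M} {s : Set V}
    (hf : ContMDiffOn 𝓘(ℝ, V) (𝓡 (2 * n)) ∞ f s) (hs : UniqueDiffOn ℝ s) (a b : V) :
    ContinuousOn (fun z => σ (f z)
      ![(mfderivWithin 𝓘(ℝ, V) (𝓡 (2 * n)) f s z : V →L[ℝ] TangentSpace (𝓡 (2 * n)) (f z)) a,
        (mfderivWithin 𝓘(ℝ, V) (𝓡 (2 * n)) f s z : V →L[ℝ] TangentSpace (𝓡 (2 * n)) (f z)) b])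
      s := by
  intro z₀ hz₀
  set φ := chartAt (Model n) (f z₀) with hφ
  have hmem := chartAt_mem (n := n) (f z₀)
  have hz₀s : f z₀ ∈ φ.source := mem_chart_source _ _
  have hfc : ContinuousWithinAt f s z₀ := hf.continuousOn z₀ hz₀
  have hφs : ContMDiffAt (𝓡 (2 * n)) 𝓘(ℝ, Model n) ∞ φ (f z₀) :=
    (contMDiffOn_of_mem_maximalAtlas hmem).contMDiffAt (φ.open_source.mem_nhds hz₀s)
  have hcd : ContDiffWithinAt ℝ ∞ (φ ∘ f) s z₀ :=
    (hφs.comp_contMDiffWithinAt z₀ (hf z₀ hz₀)).contDiffWithinAt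
  have hd : ContinuousWithinAt (fderivWithin ℝ (φ ∘ f) s) s z₀ :=
    (hcd.fderivWithin_right (m := 0) hs (by simp) hz₀).continuousWithinAt
  have hform : ContinuousWithinAt (fun z => inChart σ φ (φ (f z))) s z₀ :=
    ContinuousAt.comp_continuousWithinAt (g := fun x => inChart σ φ (φ x))
      (continuousAt_inChart hσ hmem hz₀s) hfc
  have hvec : ContinuousWithinAt (fun z => (![fderivWithin ℝ (φ ∘ f) s z a,
      fderivWithin ℝ (φ ∘ f) s z b] : Fin 2 → Model n)) s z₀ := by
    refine continuousWithinAt_pi.2 fun i => ?_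
    fin_cases i
    · exact hd.clm_apply continuousWithinAt_const
    · exact hd.clm_apply continuousWithinAt_const
  have happ : Continuous (fun q : (Model n [⋀^Fin 2]→L[ℝ] ℝ) × (Fin 2 → Model n) => q.1 q.2) := by
    fun_prop
  have hall := happ.continuousAt.comp_continuousWithinAt (hform.prodMk hvec)
  have key : ∀ z ∈ s, f z ∈ φ.source → ∀ c : V,
      fderivWithin ℝ (φ ∘ f) s z c = diff φ (f z)
        ((mfderivWithin 𝓘(ℝ, V) (𝓡 (2 * n)) f s z : V →L[ℝ] TangentSpace (𝓡 (2 * n)) (f z)) c) := by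
    intro z hz hzs c
    have h1 := mfderiv_comp_mfderivWithin (x := z) (s := s) (f := f) (g := φ)
      ((chart_mdifferentiable hmem).mdifferentiableAt hzs)
      ((hf z hz).mdifferentiableWithinAt (by simp)) (hs z hz).uniqueMDiffWithinAt
    rw [← mfderivWithin_eq_fderivWithin]
    exact DFunLike.congr_fun h1 c
  refine hall.congr_of_eventuallyEq ?_ ?_
  · filter_upwards [self_mem_nhdsWithin, hfc.eventually (φ.open_source.mem_nhds hz₀s)]
      with z hz hzs
    rw [form_eq_inChart σ hmem hzs, ← key z hz hzs, ← key z hz hzs]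
    rfl
  · rw [form_eq_inChart σ hmem hz₀s, ← key z₀ hz₀ hz₀s, ← key z₀ hz₀ hz₀s]
    rfl

lemma continuous_pullback_dS_dT {σ : TwoForm n M} (hσ : IsSmoothForm σ) {u : ℝ × ℝ → M}
    (hu : ContMDiff 𝓘(ℝ, ℝ × ℝ) (𝓡 (2 * n)) ∞ u) :
    Continuous (fun p => σ (u p) ![dS u p, dT u p]) := by
  have := continuousOn_pullback hσ hu.contMDiffOn uniqueDiffOn_univ ((1, 0) : ℝ × ℝ) (0, 1)
  rw [← continuousOn_univ]
  simp only [mfderivWithin_univ] at this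
  exact this

/-- The integrand of `discIntegral` is integrable. -/
lemma integrableOn_disc {σ : TwoForm n M} (hσ : IsSmoothForm σ) {w : ℂ → M}
    (hw : ContMDiffOn 𝓘(ℝ, ℂ) (𝓡 (2 * n)) ∞ w (Metric.closedBall 0 1)) :
    IntegrableOn (fun z => σ (w z)
      ![(mfderiv 𝓘(ℝ, ℂ) (𝓡 (2 * n)) w z : ℂ →L[ℝ] TangentSpace (𝓡 (2 * n)) (w z)) (1 : ℂ),
        (mfderiv 𝓘(ℝ, ℂ) (𝓡 (2 * n)) w z : ℂ →L[ℝ] TangentSpace (𝓡 (2 * n)) (w z)) Complex.I])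
      (Metric.ball 0 1) := by
  have hU : UniqueDiffOn ℝ (Metric.closedBall (0 : ℂ) 1) :=
    uniqueDiffOn_convex (convex_closedBall 0 1) (by
      rw [interior_closedBall _ one_ne_zero]; exact ⟨0, by simp⟩)
  have h1 := ((continuousOn_pullback hσ hw hU 1 Complex.I).integrableOn_compact
    (μ := volume) (isCompact_closedBall 0 1)).mono_set Metric.ball_subset_closedBall
  refine h1.congr_fun (fun z hz => ?_) measurableSet_ball
  have : mfderivWithin 𝓘(ℝ, ℂ) (𝓡 (2 * n)) w (Metric.closedBall 0 1) z =
      mfderiv 𝓘(ℝ, ℂ) (𝓡 (2 * n)) w z :=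
    mfderivWithin_of_mem_nhds (mem_of_superset (Metric.isOpen_ball.mem_nhds hz)
      Metric.ball_subset_closedBall)
  simp only [this]

lemma discIntegral_add {σ τ : TwoForm n M} (hσ : IsSmoothForm σ) (hτ : IsSmoothForm τ) {w : ℂ → M}
    (hw : ContMDiffOn 𝓘(ℝ, ℂ) (𝓡 (2 * n)) ∞ w (Metric.closedBall 0 1)) :
    discIntegral (σ + τ) w = discIntegral σ w + discIntegral τ w :=
  integral_add (integrableOn_disc hσ hw) (integrableOn_disc hτ hw)

/-! ### An integral estimate on a strip -/

lemma integral_strip_swap {f : ℝ × ℝ → ℝ} (hf : Continuous f) (a b c d : ℝ) :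
    ∫ s in a..b, ∫ t in c..d, f (s, t) = ∫ t in c..d, ∫ s in a..b, f (s, t) := by
  refine intervalIntegral_intervalIntegral_swap ?_
  exact (hf.continuousOn.integrableOn_compact (isCompact_uIcc.prod isCompact_uIcc)).mono_set
    (prod_mono uIoc_subset_uIcc uIoc_subset_uIcc)

lemma continuous_integral_fiber {f : ℝ × ℝ → ℝ} (hf : Continuous f) (a b : ℝ) :
    Continuous fun s => ∫ t in a..b, f (s, t) :=
  intervalIntegral.continuous_parametric_intervalIntegral_of_continuous'
    (f := fun s t => f (s, t)) hf a b

lemma continuous_integral_fiber' {f : ℝ × ℝ → ℝ} (hf : Continuous f) (a b : ℝ) :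
    Continuous fun t => ∫ s in a..b, f (s, t) :=
  intervalIntegral.continuous_parametric_intervalIntegral_of_continuous'
    (f := fun t s => f (s, t)) (hf.comp continuous_swap) a b

/-- The strip estimate. Here `q` plays the role of the energy density and `b` that of the
perturbation term, which is controlled by `q + 1` only. The constant is absorbed since for
`s ≤ 0` either the slice has a definite amount of energy or `b` vanishes on it, and since for
`0 ≤ s ≤ 1` either the total energy is at least `N`, or some slice over `[-1, 0]` has energy at most
`N` and then every line `t = const` on which `b` does not vanish carries energy at least `c`. -/
lemma integral_strip_le {q b : ℝ × ℝ → ℝ} (hq : Continuous q) (hb : Continuous b)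
    (hq0 : ∀ p, 0 ≤ q p) {A N c E : ℝ} (hA : 0 ≤ A) (hN : 0 < N)
    (hc : 0 < c) (hE : ∀ x y, x ≤ y → ∫ s in x..y, ∫ t in (0 : ℝ)..1, q (s, t) ≤ E)
    (hbq : ∀ p, b p ≤ A * (q p + 1))
    (hpos : ∀ s, 1 ≤ s → ∀ t, b (s, t) = 0)
    (hneg : ∀ s ≤ 0, ∫ t in (0 : ℝ)..1, q (s, t) ≤ N → ∀ t, b (s, t) = 0)
    (hmid : ∀ s₀ ∈ Icc (-1 : ℝ) 0, ∫ t in (0 : ℝ)..1, q (s₀, t) ≤ N →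
      ∀ t, (∃ s ∈ Icc (0 : ℝ) 1, b (s, t) ≠ 0) → c ≤ ∫ s in (-1 : ℝ)..1, q (s, t))
    {S : ℝ} (hS : 1 ≤ S) :
    ∫ s in (-S)..S, ∫ t in (0 : ℝ)..1, b (s, t) ≤ A * (2 + 2 / N + 1 / c) * E := by
  have hqi : ∀ s x y, IntervalIntegrable (fun t => q (s, t)) volume x y := fun s x y =>
    (hq.comp (by fun_prop : Continuous fun t => (s, t))).intervalIntegrable _ _
  have hqi' : ∀ t x y, IntervalIntegrable (fun s => q (s, t)) volume x y := fun t x y =>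
    (hq.comp (by fun_prop : Continuous fun s => (s, t))).intervalIntegrable _ _
  have hbi : ∀ s x y, IntervalIntegrable (fun t => b (s, t)) volume x y := fun s x y =>
    (hb.comp (by fun_prop : Continuous fun t => (s, t))).intervalIntegrable _ _
  have hbi' : ∀ t x y, IntervalIntegrable (fun s => b (s, t)) volume x y := fun t x y =>
    (hb.comp (by fun_prop : Continuous fun s => (s, t))).intervalIntegrable _ _
  have hec := continuous_integral_fiber hq 0 1
  have hbc := continuous_integral_fiber hb 0 1
  have he0 : ∀ s, 0 ≤ ∫ t in (0 : ℝ)..1, q (s, t) := fun s =>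
    intervalIntegral.integral_nonneg zero_le_one fun t _ => hq0 _
  have hE0 : 0 ≤ E := by simpa using hE 0 0 le_rfl
  -- the bound by `A * (energy + 1)` on slices and lines
  have hslice : ∀ s, ∫ t in (0 : ℝ)..1, b (s, t) ≤ A * ((∫ t in (0 : ℝ)..1, q (s, t)) + 1) := by
    intro s
    have h1 : ∫ t in (0 : ℝ)..1, b (s, t) ≤ ∫ t in (0 : ℝ)..1, A * (q (s, t) + 1) :=
      intervalIntegral.integral_mono_on zero_le_one (hbi _ _ _)
        (((hqi _ _ _).add (by simp)).const_mul A) fun t _ => hbq _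
    rw [intervalIntegral.integral_const_mul, intervalIntegral.integral_add (hqi _ _ _) (by simp)]
      at h1
    simpa using h1
  have hline : ∀ t, ∫ s in (0 : ℝ)..1, b (s, t) ≤ A * ((∫ s in (0 : ℝ)..1, q (s, t)) + 1) := by
    intro t
    have h1 : ∫ s in (0 : ℝ)..1, b (s, t) ≤ ∫ s in (0 : ℝ)..1, A * (q (s, t) + 1) :=
      intervalIntegral.integral_mono_on zero_le_one (hbi' _ _ _)
        (((hqi' _ _ _).add (by simp)).const_mul A) fun t _ => hbq _
    rw [intervalIntegral.integral_const_mul, intervalIntegral.integral_add (hqi' _ _ _) (by simp)]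
      at h1
    simpa using h1
  -- the half strip `s ≤ 0`
  have p1 : ∫ s in (-S)..0, ∫ t in (0 : ℝ)..1, b (s, t) ≤ A * (1 + 1 / N) * E := by
    have h1 : ∫ s in (-S)..0, ∫ t in (0 : ℝ)..1, b (s, t) ≤
        ∫ s in (-S)..0, A * (1 + 1 / N) * ∫ t in (0 : ℝ)..1, q (s, t) := by
      refine intervalIntegral.integral_mono_on (by linarith) (hbc.intervalIntegrable _ _)
        ((hec.const_mul _).intervalIntegrable _ _) fun s hs => ?_
      rcases le_or_gt (∫ t in (0 : ℝ)..1, q (s, t)) N with h | h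
      · simp only [hneg s hs.2 h, intervalIntegral.integral_zero]
        have := he0 s
        positivity
      · refine (hslice s).trans ?_
        have : 1 ≤ 1 / N * ∫ t in (0 : ℝ)..1, q (s, t) := by
          rw [one_div, inv_mul_eq_div, le_div_iff₀ hN]; linarith
        rw [mul_assoc]
        gcongr
        linarith
    refine h1.trans ?_
    rw [intervalIntegral.integral_const_mul]
    gcongr
    exact hE _ _ (by linarith)
  -- the strip `0 ≤ s ≤ 1`
  have p2 : ∫ s in (0 : ℝ)..1, ∫ t in (0 : ℝ)..1, b (s, t) ≤ A * (1 + 1 / N + 1 / c) * E := by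
    rcases le_or_gt N E with hNE | hNE
    · have h1 : ∫ s in (0 : ℝ)..1, ∫ t in (0 : ℝ)..1, b (s, t) ≤
          ∫ s in (0 : ℝ)..1, A * ((∫ t in (0 : ℝ)..1, q (s, t)) + 1) :=
        intervalIntegral.integral_mono_on zero_le_one (hbc.intervalIntegrable _ _)
          (((hec.add_const 1).const_mul A).intervalIntegrable _ _) fun s _ => hslice s
      rw [intervalIntegral.integral_const_mul,
        intervalIntegral.integral_add (hec.intervalIntegrable _ _) (by simp)] at h1
      have h2 := hE 0 1 zero_le_one
      have h3 : 1 ≤ 1 / N * E := by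
        rw [one_div, inv_mul_eq_div, le_div_iff₀ hN]; linarith
      have h4 : 0 ≤ 1 / c * E := by positivity
      simp only [intervalIntegral.integral_const, sub_zero, smul_eq_mul, mul_one] at h1
      refine h1.trans ?_
      rw [mul_assoc]
      gcongr
      linarith
    · obtain ⟨s₀, hs₀, hs₀N⟩ : ∃ s₀ ∈ Icc (-1 : ℝ) 0, ∫ t in (0 : ℝ)..1, q (s₀, t) ≤ N := by
        by_contra! h
        have h1 : ∫ s in (-1 : ℝ)..0, N ≤ ∫ s in (-1 : ℝ)..0, ∫ t in (0 : ℝ)..1, q (s, t) :=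
          intervalIntegral.integral_mono_on (by norm_num) (by simp)
            (hec.intervalIntegrable _ _) fun s hs => (h s hs).le
        have h2 := hE (-1) 0 (by norm_num)
        simp at h1
        linarith
      have h0 : ∀ t, 0 ≤ ∫ s in (-1 : ℝ)..1, q (s, t) := fun t =>
        intervalIntegral.integral_nonneg (by norm_num) fun s _ => hq0 _
      have hl : ∀ t, ∫ s in (0 : ℝ)..1, b (s, t) ≤
          A * (1 + 1 / c) * ∫ s in (-1 : ℝ)..1, q (s, t) := by
        intro t
        by_cases h : ∃ s ∈ Icc (0 : ℝ) 1, b (s, t) ≠ 0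
        · have h1 := hmid s₀ hs₀ hs₀N t h
          have h2 : ∫ s in (0 : ℝ)..1, q (s, t) ≤ ∫ s in (-1 : ℝ)..1, q (s, t) :=
            intervalIntegral.integral_mono_interval (by norm_num) zero_le_one le_rfl
              (Eventually.of_forall fun s => hq0 _) (hqi' _ _ _)
          have h3 : 1 ≤ 1 / c * ∫ s in (-1 : ℝ)..1, q (s, t) := by
            rw [one_div, inv_mul_eq_div, le_div_iff₀ hc]; linarith
          refine (hline t).trans ?_
          rw [mul_assoc]
          gcongr
          linarith
        · push Not at h
          have : ∫ s in (0 : ℝ)..1, b (s, t) = ∫ s in (0 : ℝ)..1, (0 : ℝ) :=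
            intervalIntegral.integral_congr fun s hs => h s (by rwa [uIcc_of_le zero_le_one] at hs)
          rw [this]
          have := h0 t
          simp only [intervalIntegral.integral_zero]
          positivity
      rw [integral_strip_swap hb]
      have h1 : ∫ t in (0 : ℝ)..1, ∫ s in (0 : ℝ)..1, b (s, t) ≤
          ∫ t in (0 : ℝ)..1, A * (1 + 1 / c) * ∫ s in (-1 : ℝ)..1, q (s, t) :=
        intervalIntegral.integral_mono_on zero_le_one
          ((continuous_integral_fiber' hb 0 1).intervalIntegrable _ _)
          (((continuous_integral_fiber' hq (-1) 1).const_mul _).intervalIntegrable _ _)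
          fun t _ => hl t
      rw [intervalIntegral.integral_const_mul, ← integral_strip_swap hq] at h1
      have h2 := hE (-1) 1 (by norm_num)
      refine h1.trans ?_
      have h3 : A * (1 + 1 / c) ≤ A * (1 + 1 / N + 1 / c) := by
        gcongr
        have : 0 ≤ 1 / N := by positivity
        linarith
      gcongr
      exact intervalIntegral.integral_nonneg (by norm_num) fun s _ => he0 s
  have p3 : ∫ s in (1 : ℝ)..S, ∫ t in (0 : ℝ)..1, b (s, t) = 0 := by
    have : ∫ s in (1 : ℝ)..S, ∫ t in (0 : ℝ)..1, b (s, t) = ∫ s in (1 : ℝ)..S, (0 : ℝ) := by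
      refine intervalIntegral.integral_congr fun s hs => ?_
      rw [uIcc_of_le hS] at hs
      simp only [hpos s hs.1, intervalIntegral.integral_zero]
    simpa using this
  have hi : ∀ x y, IntervalIntegrable (fun s => ∫ t in (0 : ℝ)..1, b (s, t)) volume x y :=
    fun x y => hbc.intervalIntegrable _ _
  rw [← intervalIntegral.integral_add_adjacent_intervals (hi (-S) 0) (hi 0 S),
    ← intervalIntegral.integral_add_adjacent_intervals (hi 0 1) (hi 1 S), p3]
  calc _ ≤ A * (1 + 1 / N) * E + (A * (1 + 1 / N + 1 / c) * E + 0) := by gcongr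
    _ = _ := by ring

/-! ### The energy density of a Floer trajectory -/

/-- Integrals over finite parts of the strip are bounded by the integral over the strip and
converge to it. -/
lemma integral_strip_le_total {q : ℝ × ℝ → ℝ} (hq0 : ∀ p, 0 ≤ q p)
    (hi : IntegrableOn q ((univ : Set ℝ) ×ˢ Icc (0 : ℝ) 1)) :
    (∀ x y, x ≤ y → ∫ s in x..y, ∫ t in (0 : ℝ)..1, q (s, t) ≤
      ∫ p in (univ : Set ℝ) ×ˢ Icc (0 : ℝ) 1, q p) ∧
    Tendsto (fun S : ℝ => ∫ s in (-S)..S, ∫ t in (0 : ℝ)..1, q (s, t)) atTop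
      (𝓝 (∫ p in (univ : Set ℝ) ×ˢ Icc (0 : ℝ) 1, q p)) := by
  have e : ∀ s, ∫ t in (0 : ℝ)..1, q (s, t) = ∫ t in Icc (0 : ℝ) 1, q (s, t) := fun s => by
    rw [intervalIntegral.integral_of_le zero_le_one, integral_Icc_eq_integral_Ioc]
  have hprod : ∫ p in (univ : Set ℝ) ×ˢ Icc (0 : ℝ) 1, q p =
      ∫ s, ∫ t in Icc (0 : ℝ) 1, q (s, t) := by
    rw [Measure.volume_eq_prod, setIntegral_prod _ hi, setIntegral_univ]
  have hint : Integrable (fun s => ∫ t in Icc (0 : ℝ) 1, q (s, t)) := by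
    rw [IntegrableOn, Measure.volume_eq_prod, ← Measure.prod_restrict, Measure.restrict_univ] at hi
    exact hi.integral_prod_left
  have h0 : ∀ s, 0 ≤ ∫ t in Icc (0 : ℝ) 1, q (s, t) := fun s => integral_nonneg fun t => hq0 _
  simp only [e, hprod]
  refine ⟨fun x y hxy => ?_, intervalIntegral_tendsto_integral hint tendsto_neg_atTop_atBot
    tendsto_id⟩
  rw [intervalIntegral.integral_of_le hxy]
  exact setIntegral_le_integral hint (Eventually.of_forall h0)

lemma hasMFDerivAt_slice_fst {u : ℝ × ℝ → M} (hu : ContMDiff 𝓘(ℝ, ℝ × ℝ) (𝓡 (2 * n)) ∞ u)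
    (s t : ℝ) :
    HasMFDerivAt 𝓘(ℝ, ℝ) (𝓡 (2 * n)) (fun s => u (s, t)) s
      ((1 : ℝ →L[ℝ] ℝ).smulRight (dS u (s, t))) := by
  have h1 := (hu.mdifferentiable (by simp) (s, t)).hasMFDerivAt
  have h2 : HasMFDerivAt 𝓘(ℝ, ℝ) 𝓘(ℝ, ℝ × ℝ) (fun s : ℝ => (s, t)) s
      (ContinuousLinearMap.inl ℝ ℝ ℝ) := (hasFDerivAt_prodMk_left s t).hasMFDerivAt
  have h3 := HasMFDerivAt.comp s h1 h2
  have e : (1 : ℝ →L[ℝ] ℝ).smulRight (dS u (s, t)) =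
      ((mfderiv 𝓘(ℝ, ℝ × ℝ) (𝓡 (2 * n)) u (s, t) : ℝ × ℝ →L[ℝ] Model n).comp
        (ContinuousLinearMap.inl ℝ ℝ ℝ) : ℝ →L[ℝ] Model n) :=
    ContinuousLinearMap.ext_ring (one_smul ℝ (dS u (s, t)))
  exact e ▸ h3

lemma hasMFDerivAt_slice_snd {u : ℝ × ℝ → M} (hu : ContMDiff 𝓘(ℝ, ℝ × ℝ) (𝓡 (2 * n)) ∞ u)
    (s t : ℝ) :
    HasMFDerivAt 𝓘(ℝ, ℝ) (𝓡 (2 * n)) (fun t => u (s, t)) t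
      ((1 : ℝ →L[ℝ] ℝ).smulRight (dT u (s, t))) := by
  have h1 := (hu.mdifferentiable (by simp) (s, t)).hasMFDerivAt
  have h2 : HasMFDerivAt 𝓘(ℝ, ℝ) 𝓘(ℝ, ℝ × ℝ) (fun t : ℝ => (s, t)) t
      (ContinuousLinearMap.inr ℝ ℝ ℝ) := (hasFDerivAt_prodMk_right s t).hasMFDerivAt
  have h3 := HasMFDerivAt.comp t h1 h2
  have e : (1 : ℝ →L[ℝ] ℝ).smulRight (dT u (s, t)) =
      ((mfderiv 𝓘(ℝ, ℝ × ℝ) (𝓡 (2 * n)) u (s, t) : ℝ × ℝ →L[ℝ] Model n).comp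
        (ContinuousLinearMap.inr ℝ ℝ ℝ) : ℝ →L[ℝ] Model n) :=
    ContinuousLinearMap.ext_ring (one_smul ℝ (dT u (s, t)))
  exact e ▸ h3

lemma hasMFDerivAt_add_one (p : ℝ × ℝ) :
    HasMFDerivAt 𝓘(ℝ, ℝ × ℝ) 𝓘(ℝ, ℝ × ℝ) (fun p : ℝ × ℝ => p + (0, 1)) p
      (ContinuousLinearMap.id ℝ (ℝ × ℝ)) :=
  ((hasFDerivAt_id p).add_const _).hasMFDerivAt

lemma mfderiv_shift {u : ℝ × ℝ → M} (hu : ContMDiff 𝓘(ℝ, ℝ × ℝ) (𝓡 (2 * n)) ∞ u) (p : ℝ × ℝ) :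
    mfderiv 𝓘(ℝ, ℝ × ℝ) (𝓡 (2 * n)) (fun p => u (p + (0, 1))) p =
      mfderiv 𝓘(ℝ, ℝ × ℝ) (𝓡 (2 * n)) u (p + (0, 1)) := by
  have h1 := (hu.mdifferentiable (by simp) (p + (0, 1))).hasMFDerivAt
  exact (HasMFDerivAt.comp p h1 (hasMFDerivAt_add_one p)).mfderiv

/-- The integrand `ω_s(∂_s u, ∂_t u) - dH_t(∂_s u)` of the energy identity. For solutions of
Floer's equation it is the squared norm of `∂_s u`; in this form its continuity does not involve
the almost complex structure. -/
def floerDensity (σ : ℝ → TwoForm n M) (H : ℝ → M → ℝ) (u : ℝ × ℝ → M) (p : ℝ × ℝ) : ℝ :=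
  σ p.1 (u p) ![dS u p, dT u p] - diff (n := n) (H p.2) (u p) (dS u p)

/-- Periodicity is derived from the shifted map, because the tangent spaces at `u (s, t + 1)` and
`u (s, t)` are not syntactically equal. -/
lemma floerDensity_add_one (σ : ℝ → TwoForm n M) {H : ℝ → M → ℝ}
    (hH : IsHamiltonian (n := n) H) {u : ℝ × ℝ → M}
    (hu : ContMDiff 𝓘(ℝ, ℝ × ℝ) (𝓡 (2 * n)) ∞ u) (hper : ∀ s t, u (s, t + 1) = u (s, t))
    (s t : ℝ) : floerDensity σ H u (s, t + 1) = floerDensity σ H u (s, t) := by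
  have hsh : (fun p => u (p + (0, 1))) = u := by
    funext ⟨a, b⟩
    simpa using hper a b
  have h : floerDensity σ H (fun p => u (p + (0, 1))) (s, t) =
      floerDensity σ H u ((s, t) + (0, 1)) := by
    have hd : ((s, t) + (0, 1) : ℝ × ℝ).2 = t + 1 := rfl
    have hd' : ((s, t) + (0, 1) : ℝ × ℝ).1 = s := add_zero s
    simp only [floerDensity, dS, dT, mfderiv_shift hu]
    rw [hd, hd', hH.add_one]
    rfl
  have e : ((s, t) + (0, 1) : ℝ × ℝ) = (s, t + 1) := by simp
  rw [hsh, e] at h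
  exact h.symm

lemma contDiff_H_comp {H : ℝ → M → ℝ} (hH : IsHamiltonian (n := n) H) {u : ℝ × ℝ → M}
    (hu : ContMDiff 𝓘(ℝ, ℝ × ℝ) (𝓡 (2 * n)) ∞ u) :
    ContDiff ℝ ∞ (fun p : ℝ × ℝ => H p.2 (u p)) := by
  rw [← contMDiff_iff_contDiff]
  exact hH.smooth.comp (contDiff_snd.contMDiff.prodMk hu)

lemma IsHamiltonian.contMDiff_apply {H : ℝ → M → ℝ} (hH : IsHamiltonian (n := n) H) (t : ℝ) :
    ContMDiff (𝓡 (2 * n)) 𝓘(ℝ, ℝ) ∞ (H t) :=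
  hH.smooth.comp (contMDiff_const.prodMk contMDiff_id)

lemma hasDerivAt_H_slice {H : ℝ → M → ℝ} (hH : IsHamiltonian (n := n) H) {u : ℝ × ℝ → M}
    (hu : ContMDiff 𝓘(ℝ, ℝ × ℝ) (𝓡 (2 * n)) ∞ u) (s t : ℝ) :
    HasDerivAt (fun s => H t (u (s, t))) (diff (n := n) (H t) (u (s, t)) (dS u (s, t))) s :=
  hasDerivAt_comp_curve (hH.contMDiff_apply t) (hasMFDerivAt_slice_fst hu s t)

lemma continuous_diff_H_dS {H : ℝ → M → ℝ} (hH : IsHamiltonian (n := n) H) {u : ℝ × ℝ → M}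
    (hu : ContMDiff 𝓘(ℝ, ℝ × ℝ) (𝓡 (2 * n)) ∞ u) :
    Continuous (fun p : ℝ × ℝ => diff (n := n) (H p.2) (u p) (dS u p)) := by
  have hG := contDiff_H_comp hH hu
  have e : (fun p : ℝ × ℝ => diff (n := n) (H p.2) (u p) (dS u p)) =
      fun p => fderiv ℝ (fun p : ℝ × ℝ => H p.2 (u p)) p (1, 0) := by
    funext ⟨s, t⟩
    have h1 : HasFDerivAt (fun p : ℝ × ℝ => H p.2 (u p))
        (fderiv ℝ (fun p : ℝ × ℝ => H p.2 (u p)) (s, t)) (s, t) :=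
      (hG.differentiable (by simp) _).hasFDerivAt
    have h2 := (HasFDerivAt.comp s h1 (hasFDerivAt_prodMk_left s t)).hasDerivAt
    exact (hasDerivAt_H_slice hH hu s t).unique h2
  rw [e]
  exact (hG.continuous_fderiv (by simp)).clm_apply continuous_const

lemma interp_eq (ω₀ α : TwoForm n M) (κ : ℝ → ℝ) (s : ℝ) :
    interp ω₀ α κ s = ω₀ + κ s • α := rfl

lemma continuous_floerDensity {ω₀ α : TwoForm n M} (hω₀ : IsSmoothForm ω₀) (hα : IsSmoothForm α)
    {κ : ℝ → ℝ} (hκ : IsCutoff κ) {H : ℝ → M → ℝ} (hH : IsHamiltonian (n := n) H) {u : ℝ × ℝ → M}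
    (hu : ContMDiff 𝓘(ℝ, ℝ × ℝ) (𝓡 (2 * n)) ∞ u) :
    Continuous (floerDensity (interp ω₀ α κ) H u) := by
  have h1 := continuous_pullback_dS_dT hω₀ hu
  have h2 := continuous_pullback_dS_dT hα hu
  have h3 : Continuous fun p : ℝ × ℝ => κ p.1 := hκ.smooth.continuous.comp continuous_fst
  exact (h1.add (h3.mul h2)).sub (continuous_diff_H_dS hH hu)

lemma J_dS_eq {σ : ℝ → TwoForm n M} {J : EndField n M} (hJ : IsAlmostComplex J)
    {H : ℝ → M → ℝ} {u : ℝ × ℝ → M} {p : ℝ × ℝ}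
    (hp : dS u p + J (u p) (dT u p - hamVF (σ p.1) H p.2 (u p)) = 0) : J (u p) (dS u p) = dT u p - hamVF (σ p.1) H p.2 (u p) := by
  rw [eq_neg_of_add_eq_zero_left hp, map_neg, hJ.sq_eq, neg_neg]

lemma floerDensity_eq {σ : ℝ → TwoForm n M} {J : EndField n M} (hJ : IsAlmostComplex J)
    {H : ℝ → M → ℝ} {u : ℝ × ℝ → M} {p : ℝ × ℝ}
    (hp : dS u p + J (u p) (dT u p - hamVF (σ p.1) H p.2 (u p)) = 0)
    (ht : Tames (σ p.1) J) :
    floerDensity σ H u p = σ p.1 (u p) ![dS u p, J (u p) (dS u p)] := by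
  rw [J_dS_eq hJ hp, form_sub_right, ht.hamVF_spec]
  rfl

lemma energyDensity_eq {σ : ℝ → TwoForm n M} {J : EndField n M} (hJ : IsAlmostComplex J)
    {H : ℝ → M → ℝ} {u : ℝ × ℝ → M} {p : ℝ × ℝ}
    (hp : dS u p + J (u p) (dT u p - hamVF (σ p.1) H p.2 (u p)) = 0)
    (ht : Tames (σ p.1) J) :
    energyDensity σ J H u p = 2 * floerDensity σ H u p := by
  rw [energyDensity, metric, metric, ← J_dS_eq hJ hp, form_J_self hJ, floerDensity_eq hJ hp ht]
  ring

lemma tameNorm_deviation_sq {σ : ℝ → TwoForm n M} {J : EndField n M} (hJ : IsAlmostComplex J)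
    {H : ℝ → M → ℝ} {u : ℝ × ℝ → M} {p : ℝ × ℝ}
    (hp : dS u p + J (u p) (dT u p - hamVF (σ p.1) H p.2 (u p)) = 0)
    (ht : Tames (σ p.1) J) :
    tameNorm (σ p.1) J (u p) (dT u p - hamVF (σ p.1) H p.2 (u p)) ^ 2 = floerDensity σ H u p := by
  rw [← J_dS_eq hJ hp, tameNorm_J hJ, ht.tameNorm_sq, floerDensity_eq hJ hp ht]

lemma tendsto_integral_H [CompactSpace M] {H : ℝ → M → ℝ} (hH : IsHamiltonian (n := n) H)
    {l : Filter ℝ} [l.IsCountablyGenerated] {u : ℝ × ℝ → M} (hu : Continuous u) {γ : ℝ → M}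
    (hlim : ∀ t, Tendsto (fun s => u (s, t)) l (𝓝 (γ t))) :
    Tendsto (fun s => ∫ t in (0 : ℝ)..1, H t (u (s, t))) l (𝓝 (∫ t in (0 : ℝ)..1, H t (γ t))) := by
  have hc : Continuous (fun p : ℝ × M => H p.1 p.2) := hH.smooth.continuous
  obtain ⟨K, hK⟩ := ((isCompact_Icc (a := (0 : ℝ)) (b := 1)).prod
    (isCompact_univ (X := M))).exists_bound_of_continuousOn hc.continuousOn
  refine intervalIntegral.tendsto_integral_filter_of_dominated_convergence (fun _ => K) ?_ ?_
    (by simp) ?_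
  · refine Eventually.of_forall fun s => ?_
    exact (hc.comp (continuous_id.prodMk (hu.comp (by fun_prop : Continuous fun t : ℝ => (s, t)))))
      |>.aestronglyMeasurable
  · refine Eventually.of_forall fun s => Eventually.of_forall fun t ht => ?_
    rw [uIoc_of_le zero_le_one] at ht
    exact hK (t, u (s, t)) ⟨Ioc_subset_Icc_self ht, mem_univ _⟩
  · refine Eventually.of_forall fun t _ => ?_
    exact ((hH.contMDiff_apply t).continuous.tendsto _).comp (hlim t)

/-! ### Action and energy -/

/-- The integrand `(1 - κ(s)) α(∂_s u, ∂_t u)` of the error term in the energy identity. It is the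
difference of the pull-backs of `ω₀ + α` and of `ω_s`. -/
def defect (α : TwoForm n M) (κ : ℝ → ℝ) (u : ℝ × ℝ → M) (p : ℝ × ℝ) : ℝ :=
  (1 - κ p.1) * α (u p) ![dS u p, dT u p]

lemma continuous_defect {α : TwoForm n M} (hα : IsSmoothForm α) {κ : ℝ → ℝ} (hκ : IsCutoff κ)
    {u : ℝ × ℝ → M} (hu : ContMDiff 𝓘(ℝ, ℝ × ℝ) (𝓡 (2 * n)) ∞ u) :
    Continuous (defect α κ u) :=
  (continuous_const.sub (hκ.smooth.continuous.comp continuous_fst)).mul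
    (continuous_pullback_dS_dT hα hu)

/-- The integral of the defect over the strip is at most a constant times the norm of the
perturbation times the energy. -/
lemma exists_integral_defect_le [T2Space M] [CompactSpace M]
    (B : BallCover n M) (ε : ℕ → ℝ) (hε : ∀ k, 0 < ε k)
    (ω₀ : TwoForm n M) (hω₀ : IsSymplectic ω₀)
    (J : EndField n M) (hJ : IsAlmostComplex J)
    (H : ℝ → M → ℝ) (hH : IsHamiltonian (n := n) H)
    (δ δ₁ : ℝ) (hδ : 0 < δ) (hδ₁ : δ < δ₁)
    (htame : ∀ β, IsPerturbation B ε ω₀ H δ₁ β → Tames (ω₀ + β) J)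
    (U : Set M) (hU : IsOpen U) (horbits : ∀ x, IsPeriodicOrbit ω₀ H x → range x ⊆ U) :
    ∃ K : ℝ, 0 ≤ K ∧ ∀ α, IsPerturbation B ε ω₀ H δ α → (∀ x ∈ U, α x = 0) →
      ∀ κ, IsCutoff κ → ∀ u : ℝ × ℝ → M, ContMDiff 𝓘(ℝ, ℝ × ℝ) (𝓡 (2 * n)) ∞ u →
      (∀ s t, u (s, t + 1) = u (s, t)) →
      (∀ p : ℝ × ℝ, dS u p + J (u p) (dT u p - hamVF (interp ω₀ α κ p.1) H p.2 (u p)) = 0) →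
      ∀ E, (∀ x y, x ≤ y →
        ∫ s in x..y, ∫ t in (0 : ℝ)..1, floerDensity (interp ω₀ α κ) H u (s, t) ≤ E) →
      ∀ S, 1 ≤ S → |∫ s in (-S)..S, ∫ t in (0 : ℝ)..1, defect α κ u (s, t)| ≤
        (epsNorm B ε α).toReal * K * E := by
  have ht₀ : Tames ω₀ J := by simpa using htame 0 IsPerturbation.zero_mem
  obtain ⟨m, F, hF, hFe, -⟩ := exists_embedding_euclidean_of_compact (I := 𝓡 (2 * n)) (M := M)
  obtain ⟨KF, hKF0, hKF⟩ := ht₀.exists_diff_le_global hω₀.smooth hJ hF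
  obtain ⟨KH, hKH0, hKH⟩ := ht₀.exists_dH_le hω₀.smooth hJ hH
  obtain ⟨Kα, hKα0, hKα⟩ := ht₀.exists_form_le B (hε 0) hω₀.smooth hJ
  obtain ⟨N, r, hN, hr, hNr⟩ := ht₀.exists_almostOrbit_subset hω₀.smooth hJ hH hU horbits hF
    hFe.isEmbedding
  have hδ₁0 : 0 < δ₁ := hδ.trans hδ₁
  -- `θ` is the part of the unperturbed metric that survives in the metrics of the homotopy
  set θ := 1 - δ / δ₁ with hθ
  have hθ0 : 0 < θ := by rw [hθ, sub_pos, div_lt_one hδ₁0]; exact hδ₁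
  have hθ1 : θ ≤ 1 := by
    rw [hθ, sub_le_self_iff]; positivity
  set η := r / (2 * (KF + 1)) with hη
  have hη0 : 0 < η := by positivity
  set c := r * θ * η / (KF + 1) with hc
  have hc0 : 0 < c := by positivity
  refine ⟨Kα * (1 + KH / θ) / θ * (2 + 2 / N + 1 / c), by positivity, ?_⟩
  intro α hα hαU κ hκ u hu hper hfl E hE S hS
  have htop : epsNorm B ε α ≠ ⊤ := (hα.norm_le.trans_lt ENNReal.ofReal_lt_top).ne
  set a := (epsNorm B ε α).toReal with ha
  have ha0 : 0 ≤ a := ENNReal.toReal_nonneg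
  set σ := interp ω₀ α κ with hσ
  have hts : ∀ s, Tames (σ s) J := fun s => (hα.tame_interp hδ hδ₁ htame (hκ.mem_Icc s)).1
  have hdom : ∀ s x, ∀ v : TangentSpace (𝓡 (2 * n)) x,
      θ * ω₀ x ![v, J x v] ≤ σ s x ![v, J x v] :=
    fun s => (hα.tame_interp hδ hδ₁ htame (hκ.mem_Icc s)).2
  set q := floerDensity σ H u with hq
  have hqc : Continuous q := continuous_floerDensity hω₀.smooth hα.smooth hκ hH hu
  have hqeq : ∀ p, q p = σ p.1 (u p) ![dS u p, J (u p) (dS u p)] := fun p =>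
    floerDensity_eq hJ (hfl p) (hts p.1)
  have hq0 : ∀ p, 0 ≤ q p := fun p => by rw [hqeq]; exact (hts p.1).nonneg _ _
  -- `|∂_s u|²` in the unperturbed metric
  have hdS : ∀ p, tameNorm ω₀ J (u p) (dS u p) ^ 2 ≤ q p / θ := by
    intro p
    rw [ht₀.tameNorm_sq, le_div_iff₀ hθ0, hqeq, mul_comm]
    exact hdom p.1 (u p) (dS u p)
  have hX : ∀ p : ℝ × ℝ, tameNorm ω₀ J (u p) (hamVF (σ p.1) H p.2 (u p)) ≤ KH / θ := fun p =>
    ht₀.tameNorm_hamVF_le hJ (hts p.1) hθ0 hKH0 (hdom p.1) hKH p.2 (u p)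
  have hαb : ∀ p, |α (u p) ![dS u p, dT u p]| ≤ a * (Kα * (1 + KH / θ) / θ) * (q p + 1) := by
    intro p
    have e : dT u p = J (u p) (dS u p) + hamVF (σ p.1) H p.2 (u p) := by
      rw [J_dS_eq hJ (hfl p), sub_add_cancel]
    set d := tameNorm ω₀ J (u p) (dS u p) with hd
    have hd0 : 0 ≤ d := tameNorm_nonneg _ _ _ _
    have h1 := hKα α htop (u p) (dS u p) (J (u p) (dS u p))
    have h2 := hKα α htop (u p) (dS u p) (hamVF (σ p.1) H p.2 (u p))
    rw [tameNorm_J hJ] at h1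
    rw [e, form_add_right]
    have hdq : d ^ 2 ≤ q p / θ := hdS p
    have hqθ : 1 ≤ 1 / θ := by rw [le_div_iff₀ hθ0]; linarith
    have h4 : d ^ 2 + 1 ≤ (q p + 1) / θ := by rw [add_div]; linarith
    have h5 : d ≤ d ^ 2 + 1 := by nlinarith
    have hXp := hX p
    have hKHθ : 0 ≤ KH / θ := by positivity
    calc |α (u p) ![dS u p, J (u p) (dS u p)] + α (u p) ![dS u p, hamVF (σ p.1) H p.2 (u p)]|
        ≤ _ := abs_add_le _ _
      _ ≤ a * (Kα * (d * d)) + a * (Kα * (d * (KH / θ))) := by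
          refine add_le_add h1 (h2.trans ?_)
          gcongr
      _ = a * Kα * (d ^ 2 + d * (KH / θ)) := by ring
      _ ≤ a * Kα * ((d ^ 2 + 1) + (d ^ 2 + 1) * (KH / θ)) := by
          gcongr
          linarith
      _ = a * Kα * (1 + KH / θ) * (d ^ 2 + 1) := by ring
      _ ≤ a * Kα * (1 + KH / θ) * ((q p + 1) / θ) := by gcongr
      _ = _ := by ring
  have hκ01 : ∀ s, 0 ≤ 1 - κ s ∧ 1 - κ s ≤ 1 := fun s => by
    have := hκ.mem_Icc s
    constructor <;> linarith [this.1, this.2]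
  have hbα : ∀ p, |defect α κ u p| ≤ |α (u p) ![dS u p, dT u p]| := by
    intro p
    rw [defect, abs_mul, abs_of_nonneg (hκ01 p.1).1]
    exact mul_le_of_le_one_left (abs_nonneg _) (hκ01 p.1).2
  have hbU : ∀ p, u p ∈ U → |defect α κ u p| = 0 := by
    intro p hp
    rw [defect, hαU _ hp]
    simp
  -- slices over `s ≤ 0` are loops of the unperturbed problem
  have hslice : ∀ s ≤ 0, IsAlmostOrbit ω₀ J H (fun t => q (s, t)) (fun t => u (s, t))
      (fun t => dT u (s, t)) := by
    intro s hs
    have hσs : σ s = ω₀ := by rw [hσ, interp_eq, hκ.eq_zero s hs, zero_smul, add_zero]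
    refine ⟨fun t => hasMFDerivAt_slice_snd hu s t, fun t => hper s t,
      hqc.comp (by fun_prop), fun t => floerDensity_add_one σ hH hu hper s t, fun t => ?_⟩
    have := tameNorm_deviation_sq hJ (hfl (s, t)) (hts s)
    simp only [hσs] at this
    exact this.le
  have main := integral_strip_le (q := q) (b := fun p => |defect α κ u p|) hqc
    (continuous_defect hα.smooth hκ hu).abs hq0 (A := a * (Kα * (1 + KH / θ) / θ)) (N := N)
    (c := c) (E := E) (by positivity) hN hc0 hE (fun p => (hbα p).trans (hαb p))
    (fun s hs t => by simp [defect, hκ.eq_one s hs])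
    (fun s hs hsN t => hbU _ (hNr _ _ _ (hslice s hs) hsN t _ (by simpa using hr)))
    (fun s₀ hs₀ hs₀N t ⟨s, hs, hst⟩ => ?_) hS
  · have h0 : |∫ s in (-S)..S, ∫ t in (0 : ℝ)..1, defect α κ u (s, t)| ≤
        ∫ s in (-S)..S, ∫ t in (0 : ℝ)..1, |defect α κ u (s, t)| := by
      have hS' : -S ≤ S := by linarith
      refine (intervalIntegral.abs_integral_le_integral_abs hS').trans ?_
      have hdc := continuous_defect hα.smooth hκ hu
      refine intervalIntegral.integral_mono_on hS'
        ((continuous_integral_fiber hdc 0 1).abs.intervalIntegrable _ _)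
        ((continuous_integral_fiber hdc.abs 0 1).intervalIntegrable _ _) fun s _ => ?_
      exact intervalIntegral.abs_integral_le_integral_abs zero_le_one
    refine h0.trans (main.trans (le_of_eq ?_))
    ring
  · -- the line `t = const` runs from deep inside `U` to a point outside `U`
    have hsU : u (s, t) ∉ U := fun h => hst (hbU _ h)
    have hfar : r ≤ ‖F (u (s, t)) - F (u (s₀, t))‖ := by
      by_contra! h
      exact hsU (hNr _ _ _ (hslice s₀ hs₀.2) hs₀N t _ h)
    have hline : Continuous fun s => q (s, t) := hqc.comp (by fun_prop)
    set P : ℝ → ℝ := fun s => KF * ((q (s, t) / θ / η + η) / 2) with hP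
    have hPc : Continuous P := by fun_prop
    have hPb : ∀ s, tameNorm ω₀ J (u (s, t)) (dS u (s, t)) ≤ (q (s, t) / θ / η + η) / 2 :=
      fun s => sqrt_le_weighted hη0 (hdS (s, t))
    have hP0 : ∀ s, 0 ≤ P s := fun s =>
      mul_nonneg hKF0 ((tameNorm_nonneg _ _ _ _).trans (hPb s))
    have hd : ∀ s, HasDerivAt (fun s => F (u (s, t))) (diff F (u (s, t)) (dS u (s, t))) s :=
      fun s => hasDerivAt_comp_curve hF (hasMFDerivAt_slice_fst hu s t)
    have h1 : ‖F (u (s, t)) - F (u (s₀, t))‖ ≤ ∫ s in s₀..s, P s :=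
      norm_sub_le_integral_of_norm_deriv_le_of_le (f := fun s => F (u (s, t)))
        (hs₀.2.trans hs.1) (fun τ _ => (hd τ).continuousAt.continuousWithinAt)
        (fun τ _ => (hd τ).differentiableAt.differentiableWithinAt)
        (Eventually.of_forall fun τ _ => by
          rw [(hd τ).deriv]
          exact (hKF _ _).trans (mul_le_mul_of_nonneg_left (hPb τ) hKF0))
        (hPc.intervalIntegrable _ _)
    have h2 : ∫ s in s₀..s, P s ≤ ∫ s in (-1 : ℝ)..1, P s :=
      intervalIntegral.integral_mono_interval hs₀.1 (hs₀.2.trans hs.1) hs.2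
        (Eventually.of_forall hP0) (hPc.intervalIntegrable _ _)
    set Q := ∫ s in (-1 : ℝ)..1, q (s, t) with hQ
    have h3 : ∫ s in (-1 : ℝ)..1, P s = KF * ((Q / θ / η + 2 * η) / 2) := by
      rw [hP, intervalIntegral.integral_const_mul, intervalIntegral.integral_div,
        intervalIntegral.integral_add
          (((hline.div_const _).div_const _).intervalIntegrable _ _) (by simp),
        intervalIntegral.integral_div, intervalIntegral.integral_div,
        intervalIntegral.integral_const, ← hQ]
      norm_num
    have hQ0 : 0 ≤ Q := intervalIntegral.integral_nonneg (by norm_num) fun s _ => hq0 _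
    have h4 : r ≤ KF * ((Q / θ / η + 2 * η) / 2) := by
      rw [← h3]; exact hfar.trans (h1.trans h2)
    have h5 : KF * η ≤ r / 2 := by
      rw [hη, ← mul_div_assoc, div_le_div_iff₀ (by positivity) (by norm_num)]
      nlinarith
    have h6 : r ≤ KF * (Q / θ / η) := by nlinarith
    have h7 : r * θ * η ≤ KF * Q := by
      have e : KF * (Q / θ / η) = KF * Q / (θ * η) := by field_simp
      rw [e, le_div_iff₀ (by positivity)] at h6
      linarith
    rw [hc, div_le_iff₀ (by positivity)]
    nlinarith

lemma IsConnectingTrajectory.energy_eq {σ : ℝ → TwoForm n M} {J : EndField n M}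
    (hJ : IsAlmostComplex J) {H : ℝ → M → ℝ} (hts : ∀ s, Tames (σ s) J)
    {γm γp : ℝ → M} {wm wp : ℂ → M} {u : ℝ × ℝ → M}
    (hu : IsConnectingTrajectory σ J H γm wm γp wp u) :
    IntegrableOn (floerDensity σ H u) ((univ : Set ℝ) ×ˢ Icc (0 : ℝ) 1) ∧
      energy σ J H u = ∫ p in (univ : Set ℝ) ×ˢ Icc (0 : ℝ) 1, floerDensity σ H u p := by
  have e : energyDensity σ J H u = fun p => 2 * floerDensity σ H u p :=
    funext fun p => energyDensity_eq hJ (hu.floer p) (hts p.1)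
  constructor
  · have := hu.finite_energy.const_mul (1 / 2)
    rw [e] at this
    exact this.congr (Eventually.of_forall fun p => by ring)
  · rw [energy, e, integral_const_mul]
    ring

/-- The energy identity: up to the integral of `α` over the capping, the action difference is
minus the energy minus the limit of the integral of the defect. -/
lemma IsConnectingTrajectory.action_sub_action [CompactSpace M] {ω₀ α : TwoForm n M}
    (hω₀ : IsSmoothForm ω₀) (hω₀c : IsClosedForm ω₀) (hα : IsSmoothForm α) (hαc : IsClosedForm α)
    {κ : ℝ → ℝ} (hκ : IsCutoff κ) {J : EndField n M} (hJ : IsAlmostComplex J)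
    {H : ℝ → M → ℝ} (hH : IsHamiltonian (n := n) H) (hts : ∀ s, Tames (interp ω₀ α κ s) J)
    {γm γp : ℝ → M} {wm wp : ℂ → M} {u : ℝ × ℝ → M} (hwp : IsCapping (n := n) γp wp)
    (hu : IsConnectingTrajectory (interp ω₀ α κ) J H γm wm γp wp u) :
    Tendsto (fun S : ℝ => ∫ s in (-S)..S, ∫ t in (0 : ℝ)..1, defect α κ u (s, t)) atTop
      (𝓝 (-(action (ω₀ + α) H γp wp - action ω₀ H γm wm) - energy (interp ω₀ α κ) J H u -
        discIntegral α wm)) := by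
  set σ := interp ω₀ α κ with hσ
  obtain ⟨hqi, hEq⟩ := hu.energy_eq hJ hts
  have hq0 : ∀ p, 0 ≤ floerDensity σ H u p := fun p => by
    rw [floerDensity_eq hJ (hu.floer p) (hts p.1)]; exact (hts p.1).nonneg _ _
  have lq := (integral_strip_le_total hq0 hqi).2
  rw [← hEq] at lq
  have l0 := hu.homologous ω₀ hω₀ hω₀c
  have lα := hu.homologous α hα hαc
  have lp := (tendsto_integral_H hH hu.smooth.continuous hu.limit_pos)
  have lm := (tendsto_integral_H hH hu.smooth.continuous hu.limit_neg).comp tendsto_neg_atTop_atBot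
  have hqc := continuous_floerDensity hω₀ hα hκ hH hu.smooth
  have hdc := continuous_defect hα hκ hu.smooth
  have h0c := continuous_pullback_dS_dT hω₀ hu.smooth
  have hαcont := continuous_pullback_dS_dT hα hu.smooth
  have hHc := continuous_diff_H_dS hH hu.smooth
  have hfib : ∀ {f : ℝ × ℝ → ℝ}, Continuous f → ∀ s, IntervalIntegrable (fun t => f (s, t))
      volume 0 1 := fun hf s =>
    (hf.comp (by fun_prop : Continuous fun t => (s, t))).intervalIntegrable _ _
  have hint : ∀ {f : ℝ × ℝ → ℝ}, Continuous f → ∀ S : ℝ,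
      IntervalIntegrable (fun s => ∫ t in (0 : ℝ)..1, f (s, t)) volume (-S) S := fun hf S =>
    (continuous_integral_fiber hf 0 1).intervalIntegrable _ _
  have hadd : ∀ {f g : ℝ × ℝ → ℝ}, Continuous f → Continuous g → ∀ S : ℝ,
      ∫ s in (-S)..S, ∫ t in (0 : ℝ)..1, (f (s, t) + g (s, t)) =
        (∫ s in (-S)..S, ∫ t in (0 : ℝ)..1, f (s, t)) +
          ∫ s in (-S)..S, ∫ t in (0 : ℝ)..1, g (s, t) := by
    intro f g hf hg S
    rw [← intervalIntegral.integral_add (hint hf S) (hint hg S)]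
    refine intervalIntegral.integral_congr fun s _ => ?_
    exact intervalIntegral.integral_add (hfib hf s) (hfib hg s)
  -- the Hamiltonian term is integrated by the fundamental theorem of calculus
  have hHint : ∀ S : ℝ, ∫ s in (-S)..S, ∫ t in (0 : ℝ)..1,
      diff (n := n) (H t) (u (s, t)) (dS u (s, t)) =
        (∫ t in (0 : ℝ)..1, H t (u (S, t))) - ∫ t in (0 : ℝ)..1, H t (u (-S, t)) := by
    intro S
    have hGc := (contDiff_H_comp hH hu.smooth).continuous
    rw [integral_strip_swap hHc, ← intervalIntegral.integral_sub (hfib hGc S) (hfib hGc (-S))]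
    refine intervalIntegral.integral_congr fun t _ => ?_
    exact intervalIntegral.integral_eq_sub_of_hasDerivAt
      (fun s _ => hasDerivAt_H_slice hH hu.smooth s t)
      ((hHc.comp (by fun_prop : Continuous fun s => (s, t))).intervalIntegrable _ _)
  have hsum : ∀ S : ℝ,
      (∫ s in (-S)..S, ∫ t in (0 : ℝ)..1, ω₀ (u (s, t)) ![dS u (s, t), dT u (s, t)]) +
        (∫ s in (-S)..S, ∫ t in (0 : ℝ)..1, α (u (s, t)) ![dS u (s, t), dT u (s, t)]) =
      (∫ s in (-S)..S, ∫ t in (0 : ℝ)..1, floerDensity σ H u (s, t)) +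
        (((∫ t in (0 : ℝ)..1, H t (u (S, t))) - ∫ t in (0 : ℝ)..1, H t (u (-S, t))) +
        ∫ s in (-S)..S, ∫ t in (0 : ℝ)..1, defect α κ u (s, t)) := by
    intro S
    rw [← hHint S]
    refine (hadd h0c hαcont S).symm.trans (Eq.trans ?_ ((hadd hqc (hHc.add hdc) S).trans
      (congrArg _ (hadd hHc hdc S))))
    refine intervalIntegral.integral_congr fun s _ => intervalIntegral.integral_congr fun t _ => ?_
    have e : interp ω₀ α κ s (u (s, t)) ![dS u (s, t), dT u (s, t)] =
        ω₀ (u (s, t)) ![dS u (s, t), dT u (s, t)] +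
          κ s * α (u (s, t)) ![dS u (s, t), dT u (s, t)] := rfl
    simp only [Pi.add_apply, floerDensity, defect, e]
    ring
  have key := (((l0.sub_const (discIntegral ω₀ wm)).add
    (lα.sub_const (discIntegral α wm))).sub lq).sub (lp.sub lm)
  have hlim : -(action (ω₀ + α) H γp wp - action ω₀ H γm wm) - energy σ J H u -
      discIntegral α wm = discIntegral ω₀ wp - discIntegral ω₀ wm +
        (discIntegral α wp - discIntegral α wm) - energy σ J H u -
        ((∫ t in (0 : ℝ)..1, H t (γp t)) - ∫ t in (0 : ℝ)..1, H t (γm t)) := by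
    rw [action, action, discIntegral_add hω₀ hα hwp.smooth]
    ring
  rw [hlim]
  refine key.congr fun S => ?_
  have := hsum S
  simp only [Function.comp_apply]
  linarith

end Estimates

end FloerPerturbation

end

theorem proposition1p5 {n : ℕ} {M : Type*} [TopologicalSpace M] [T2Space M] [CompactSpace M]
    [ChartedSpace (FloerPerturbation.Model n) M] [IsManifold (𝓡 (2 * n)) ∞ M]
    (B : FloerPerturbation.BallCover n M) (ε : ℕ → ℝ) (hε : ∀ k, 0 < ε k)
    (ω₀ : FloerPerturbation.TwoForm n M) (hω₀ : FloerPerturbation.IsSymplectic ω₀)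
    (J : FloerPerturbation.EndField n M) (hJ : FloerPerturbation.IsAlmostComplex J)
    (H : ℝ → M → ℝ) (hH : FloerPerturbation.IsHamiltonian (n := n) H)
    (δ δ₁ : ℝ) (hδ : 0 < δ) (hδ₁ : δ < δ₁)
    (htame : ∀ β, FloerPerturbation.IsPerturbation B ε ω₀ H δ₁ β →
      FloerPerturbation.Tames (ω₀ + β) J)
    (U : Set M) (hU : IsOpen U)
    (horbits : ∀ x, FloerPerturbation.IsPeriodicOrbit ω₀ H x → Set.range x ⊆ U) :
    ∃ C N : ℝ, 0 ≤ C ∧ 0 < N ∧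
      ∀ α, FloerPerturbation.IsPerturbation B ε ω₀ H δ α → (∀ x ∈ U, α x = 0) →
      ∀ κ, FloerPerturbation.IsCutoff κ →
      ∀ (γm : ℝ → M) (wm : ℂ → M) (γp : ℝ → M) (wp : ℂ → M) (u : ℝ × ℝ → M),
        FloerPerturbation.IsCapping (n := n) γm wm → FloerPerturbation.IsCapping (n := n) γp wp →
        FloerPerturbation.IsConnectingTrajectory (FloerPerturbation.interp ω₀ α κ) J H
          γm wm γp wp u →
        ∀ E C' : ℝ, E = FloerPerturbation.energy (FloerPerturbation.interp ω₀ α κ) J H u →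
          C' = (FloerPerturbation.epsNorm B ε α).toReal * (C / Real.sqrt N + 1) →
          -(1 + C') * E - FloerPerturbation.discIntegral α wm ≤
              FloerPerturbation.action (ω₀ + α) H γp wp - FloerPerturbation.action ω₀ H γm wm ∧
            FloerPerturbation.action (ω₀ + α) H γp wp - FloerPerturbation.action ω₀ H γm wm ≤
              -(1 - C') * E - FloerPerturbation.discIntegral α wm := by

  obtain ⟨K, hK0, hK⟩ := FloerPerturbation.exists_integral_defect_le B ε hε ω₀ hω₀ J hJ H hH δ δ₁
    hδ hδ₁ htame U hU horbits
  refine ⟨K, 1, hK0, one_pos, ?_⟩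
  rintro α hα hαU κ hκ γm wm γp wp u - hwp hu E C' hE hC'
  have hts : ∀ s, FloerPerturbation.Tames (FloerPerturbation.interp ω₀ α κ s) J := fun s =>
    (hα.tame_interp hδ hδ₁ htame (hκ.mem_Icc s)).1
  have hq0 : ∀ p, 0 ≤ FloerPerturbation.floerDensity (FloerPerturbation.interp ω₀ α κ) H u p :=
    fun p => by
      rw [FloerPerturbation.floerDensity_eq hJ (hu.floer p) (hts p.1)]
      exact (hts p.1).nonneg _ _
  obtain ⟨hqi, hEq⟩ := hu.energy_eq hJ hts
  have hEb := (FloerPerturbation.integral_strip_le_total hq0 hqi).1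
  rw [← hEq, ← hE] at hEb
  have hE0 : 0 ≤ E := by simpa using hEb 0 0 le_rfl
  have hdef := hK α hα hαU κ hκ u hu.smooth hu.periodic hu.floer E hEb
  have hlim := (hu.action_sub_action hω₀.smooth hω₀.closed hα.smooth hα.closed hκ hJ hH hts
    hwp).abs
  have hle := le_of_tendsto hlim ((eventually_ge_atTop 1).mono hdef)
  rw [← hE] at hle
  have ha : 0 ≤ (FloerPerturbation.epsNorm B ε α).toReal := ENNReal.toReal_nonneg
  have hC : (FloerPerturbation.epsNorm B ε α).toReal * K * E ≤ C' * E := by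
    rw [hC', Real.sqrt_one, div_one]
    gcongr
    linarith
  obtain ⟨h1, h2⟩ := abs_le.1 (hle.trans hC)
  constructor <;> linarith
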